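/- A permutation class is a set of finite permutations closed downward under the containment order ($\sigma\le\pi$ if some subsequence of $\pi$ is order isomorphic to $\sigma$). It is finitely based if it equals $\mathrm{Av}(B)=\{\pi : \beta\not\le\pi \text{ for all } \beta\in B\}$ for a finite antichain $B$. Its growth rate is $\lim_{n\to\infty}|\mathcal C_n|^{1/n}$ when this limit exists, where $\mathcal C_n$ is the set of members of length $n$. Let $\mathrm{Sub}(X)$ be the set of permutations contained in some element of $X$, and let $\bigoplus\mathcal C$ be the smallest permutation class that contains $\mathcal C$ and is closed under direct sums. For $j\ge 0$ let $\mu_{2j+7}$ be the permutation of length $2j+7$ obtained from the increasing oscillation $2,4,1,6,3,8,5,\dots,2j+4,2j+1,2j+5,2j+3$ of length $2j+5$ (which is $2,4,1,5,3$ for $j=0$) by inflating its first entry $2$ and its greatest entry $2j+5$ each by a copy of $12$; for example $\mu_7=2,3,5,1,6,7,4$ and $\mu_{11}=2,3,5,1,7,4,9,6,10,11,8$. Let $U^o=\{\mu_7,\mu_9,\mu_{11},\dots\}$, and let $\xi\approx 2.30522$ be the unique positive root of $x^5-2x^4-x^2-x-1$. Proposition. For every $i\ge 0$ the class $\bigoplus\bigl(\mathrm{Sub}(U^o)\setminus\{\mu_7,\mu_9,\dots,\mu_{2i+7}\}\bigr)$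 is finitely based, and it has a growth rate $\gamma_i$, which is the greatest real root of $$(x^5-2x^4-x^2-x-1)(x+1)x^{2i+3}-1 .$$ These growth rates accumulate at $\xi$ from above: $\gamma_i>\xi$ for all $i$, and $\gamma_i\to\xi$ as $i\to\infty$. Moreover, $\xi$ is itself the growth rate of a finitely based permutation class. Consequently the second assertion of Klazar's Problem 2.7 is false: if $E^*$ is the set of growth rates of finitely based permutation classes, then it is not true that for every $\alpha\in E^*$ there is a $\delta>0$ with $(\alpha,\alpha+\delta)\cap E^*=\emptyset$. -/

import Mathlib

open Filter Topology

namespace PermClasses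

/-- Finite permutations of all lengths, a permutation of length `n` being a bijection of `Fin n`
(positions to values, both numbered from `0`). -/
abbrev FinPerm : Type := Σ n : ℕ, Equiv.Perm (Fin n)

/-- `Contained σ π`: some subsequence of `π` is order isomorphic to `σ`. -/
def Contained (σ π : FinPerm) : Prop :=
  ∃ f : Fin σ.1 → Fin π.1, StrictMono f ∧
    ∀ a b : Fin σ.1, σ.2 a < σ.2 b ↔ π.2 (f a) < π.2 (f b)

/-- A permutation class is a downset for the containment order. -/
def IsPermClass (C : Set FinPerm) : Prop :=
  ∀ σ π : FinPerm, Contained σ π → π ∈ C → σ ∈ C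

/-- `Av B`: the permutations that contain no element of `B`. -/
def Av (B : Set FinPerm) : Set FinPerm :=
  {π | ∀ β ∈ B, ¬ Contained β π}

/-- `B` is the basis of `C`: an antichain such that `C = Av B`. -/
def IsBasis (B C : Set FinPerm) : Prop :=
  IsAntichain Contained B ∧ C = Av B

/-- A class is finitely based if its basis is finite. -/
def FinitelyBased (C : Set FinPerm) : Prop :=
  ∃ B : Set FinPerm, B.Finite ∧ IsBasis B C

/-- The downward closure of a set of permutations. -/
def Sub (X : Set FinPerm) : Set FinPerm :=
  {π | ∃ τ ∈ X, Contained π τ}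

/-- The direct sum `π ⊕ σ`: `π` on the first `π.1` positions and values, followed by a copy of `σ`
on the remaining positions and values. -/
def directSum (π σ : FinPerm) : FinPerm :=
  ⟨π.1 + σ.1, finSumFinEquiv.permCongr (Equiv.Perm.sumCongr π.2 σ.2)⟩

/-- A set of permutations is sum closed if it contains the sum of any two of its members. -/
def SumClosed (C : Set FinPerm) : Prop :=
  ∀ π ∈ C, ∀ σ ∈ C, directSum π σ ∈ C

/-- The sum closure of `C`: the smallest sum closed permutation class that contains `C`. -/
def sumClosure (C : Set FinPerm) : Set FinPerm :=
  {π | ∀ D : Set FinPerm, IsPermClass D → SumClosed D → C ⊆ D → π ∈ D}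

/-- The number of members of length `n`. -/
noncomputable def count (C : Set FinPerm) (n : ℕ) : ℕ :=
  Set.ncard {π : Equiv.Perm (Fin n) | (⟨n, π⟩ : FinPerm) ∈ C}

/-- `C` has the (proper) growth rate `γ`: the `n`-th root of the number of members of length `n`
converges to `γ`. -/
def HasGrowthRate (C : Set FinPerm) (γ : ℝ) : Prop :=
  Tendsto (fun n : ℕ => (count C n : ℝ) ^ ((1 : ℝ) / (n : ℝ))) atTop (𝓝 γ)

/-- The growth rates of finitely based permutation classes. -/
def finitelyBasedGrowthRates : Set ℝ :=
  {γ | ∃ C : Set FinPerm, IsPermClass C ∧ FinitelyBased C ∧ HasGrowthRate C γ}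

/-- The entries of `μ_{2j+7}`, with positions and values numbered from `0`. -/
def muFun (j : ℕ) (p : Fin (2 * j + 7)) : Fin (2 * j + 7) :=
  if h0 : p.1 ≤ 1 then ⟨p.1 + 1, by omega⟩
  else if h1 : p.1 = 3 then ⟨0, by omega⟩
  else if h2 : p.1 = 2 * j + 6 then ⟨p.1 - 3, by omega⟩
  else if h3 : 2 * j + 4 ≤ p.1 then ⟨p.1 + 1, by omega⟩
  else if h4 : p.1 % 2 = 0 then ⟨p.1 + 2, by omega⟩
  else ⟨p.1 - 2, by omega⟩

theorem muFun_injective (j : ℕ) : Function.Injective (muFun j) := by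
  intro p q h
  rcases p with ⟨p, hp⟩
  rcases q with ⟨q, hq⟩
  simp only [muFun] at h
  ext
  split_ifs at h <;> simp only [Fin.mk.injEq] at h ⊢ <;> omega

/-- The permutation `μ_{2j+7}` of length `2j+7`: the increasing oscillation
`2, 4, 1, 6, 3, 8, 5, …, 2j+4, 2j+1, 2j+5, 2j+3` of length `2j+5` (`2, 4, 1, 5, 3` for `j = 0`),
in which the first entry `2` and the greatest entry are each inflated by `12`. In one-line notation
`μ_7 = 2,3,5,1,6,7,4`, `μ_9 = 2,3,5,1,7,4,8,9,6` and `μ_11 = 2,3,5,1,7,4,9,6,10,11,8`. -/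
noncomputable def mu (j : ℕ) : FinPerm :=
  ⟨2 * j + 7, Equiv.ofBijective (muFun j)
    (Finite.injective_iff_bijective.mp (muFun_injective j))⟩

/-- The antichain `U^o = {μ_7, μ_9, μ_11, …}`. -/
def Uo : Set FinPerm := Set.range mu

/-- The class `⊕ (Sub(U^o) \ {μ_7, μ_9, …, μ_{2i+7}})`. -/
def truncatedClass (i : ℕ) : Set FinPerm :=
  sumClosure (Sub Uo \ {π | ∃ j ≤ i, π = mu j})

end PermClasses

/-! When every element of `B` is sum indecomposable, `Av B` is sum closed and each member splits
uniquely into indecomposable summands. If s_n counts the indecomposable members of length n, the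
class has generating function 1/(1 - ∑ s_n x^n), and its growth rate is the γ with ∑ s_n γ^(-n) = 1.
Everything therefore reduces to finding indecomposables, and `tendsto_of_renewal` turns their number
into a growth rate by elementary estimates.

Reading an indecomposable permutation from left to right while avoiding 321, 4123, 3412, 314625 and
23451 leaves almost no choice (`indec_cases`): it is an increasing oscillation with thickened ends,
`fork a b m` with a, b ≤ 2, or one of four short permutations `skewInc k 1`. All of these lie in
Sub(U^o), and `mu j = fork 2 2 j`. The `mu j` form an antichain (`mu_antichain`), so deleting
finitely many of them only adds those to the forbidden patterns, and the truncated class stays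
finitely based (`truncatedClass_eq_av`). Its sequence s is 1, 1, 2, 3, 4, 4, ..., with 5 in place of
4 at odd lengths from 2i+9 on. Clearing denominators in ∑ s_n γ^(-n) = 1 gives P(γ)(γ+1)γ^(2i+3) =
1, with P the quintic. Since P grows with slope at least 1 on [2, ∞), the greatest root lies in (ξ,
ξ + 2^(-i)].

The limiting sequence 1, 1, 2, 3, 4, 4, 4, ... is realised by an unrelated finitely based class: the
indecomposable members of Av(321, 2413, 3142, 456123) are the permutations `skewInc k m` with k ≤ 2
or m ≤ 2. So ξ is itself a growth rate and a limit of larger ones, which contradicts the gap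
property. -/

namespace PermClasses

/-! ### Permutations as functions on ℕ, and containment -/

/-- The value of `π` at position `p`, as a natural number; positions beyond the length are fixed. -/
def val (π : FinPerm) (p : ℕ) : ℕ := if h : p < π.1 then (π.2 ⟨p, h⟩).1 else p

theorem val_coe (π : FinPerm) (p : Fin π.1) : val π p = (π.2 p).1 := by
  simp [val]

theorem val_of_lt {π : FinPerm} {p : ℕ} (h : p < π.1) : val π p = (π.2 ⟨p, h⟩).1 :=
  dif_pos h

theorem val_lt {π : FinPerm} {p : ℕ} (h : p < π.1) : val π p < π.1 := by
  simp [val, h]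

theorem val_inj {π : FinPerm} {p q : ℕ} (hp : p < π.1) (hq : q < π.1) (h : val π p = val π q) :
    p = q := by
  simp only [val, hp, hq, dif_pos] at h
  simpa using π.2.injective (Fin.ext h)

theorem exists_val_eq {π : FinPerm} {y : ℕ} (h : y < π.1) : ∃ p < π.1, val π p = y :=
  ⟨(π.2.symm ⟨y, h⟩).1, (π.2.symm ⟨y, h⟩).2, by simp [val_coe]⟩

theorem ext_val {π σ : FinPerm} (hl : π.1 = σ.1) (h : ∀ p < π.1, val π p = val σ p) : π = σ := by
  obtain ⟨n, π⟩ := π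
  obtain ⟨m, σ⟩ := σ
  obtain rfl : n = m := hl
  congr 1
  ext p
  simpa [val] using h p p.2

/-- The permutation of length `n` with values `F 0, …, F (n - 1)`. -/
noncomputable def ofFun (n : ℕ) (F : ℕ → ℕ) (hF : ∀ p < n, F p < n)
    (hi : ∀ p q, p < q → q < n → F p ≠ F q) : FinPerm :=
  ⟨n, Equiv.ofBijective (fun p : Fin n => (⟨F p, hF p p.2⟩ : Fin n))
    (Finite.injective_iff_bijective.mp (fun p q h => by
      have h' : F p = F q := by simpa using h
      rcases lt_trichotomy p.1 q.1 with g | g | g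
      · exact absurd h' (hi _ _ g q.2)
      · exact Fin.ext g
      · exact absurd h'.symm (hi _ _ g p.2)))⟩

@[simp] theorem ofFun_fst {n F hF hi} : (ofFun n F hF hi).1 = n := rfl

theorem val_ofFun {n F hF hi p} (h : p < n) : val (ofFun n F hF hi) p = F p := by
  rw [val_of_lt (π := ofFun n F hF hi) h]
  rfl

/-- Comparing pairs `p < q` in one direction suffices, because distinct positions carry distinct
values. -/
theorem contained_of {σ π : FinPerm} (f : ℕ → ℕ) (hf : ∀ p < σ.1, f p < π.1)
    (hm : ∀ p q, p < q → q < σ.1 → f p < f q)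
    (hv : ∀ p q, p < q → q < σ.1 → (val σ p < val σ q ↔ val π (f p) < val π (f q))) :
    Contained σ π := by
  refine ⟨fun p => ⟨f p, hf p p.2⟩, fun p q h => hm p q h q.2, fun p q => ?_⟩
  have key : val σ p < val σ q ↔ val π (f p) < val π (f q) := by
    rcases lt_trichotomy p.1 q.1 with g | g | g
    · exact hv _ _ g q.2
    · simp [g]
    · have h1 := hv _ _ g p.2
      have h2 : val σ p ≠ val σ q := fun h => by
        have := val_inj p.2 q.2 h
        omega
      have h3 : val π (f p) ≠ val π (f q) := fun h => by
        have := val_inj (hf _ p.2) (hf _ q.2) h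
        have := hm _ _ g p.2
        omega
      omega
  rw [val_coe, val_coe] at key
  simpa [val, hf p p.2, hf q q.2] using key

theorem Contained.exists_fun {σ π : FinPerm} (h : Contained σ π) :
    ∃ f : ℕ → ℕ, (∀ p < σ.1, f p < π.1) ∧ (∀ p q, p < q → q < σ.1 → f p < f q) ∧
      ∀ p q, p < σ.1 → q < σ.1 → (val σ p < val σ q ↔ val π (f p) < val π (f q)) := by
  obtain ⟨f, hf, hv⟩ := h
  refine ⟨fun p => if h : p < σ.1 then (f ⟨p, h⟩).1 else 0, ?_, ?_, ?_⟩
  · intro p hp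
    simp [hp]
  · intro p q hpq hq
    have hp : p < σ.1 := hpq.trans hq
    simp only [hp, hq, dif_pos]
    exact hf (show (⟨p, hp⟩ : Fin σ.1) < ⟨q, hq⟩ from hpq)
  · intro p q hp hq
    have := hv ⟨p, hp⟩ ⟨q, hq⟩
    simpa [val, hp, hq] using this

theorem Contained.refl (π : FinPerm) : Contained π π :=
  ⟨id, strictMono_id, fun _ _ => Iff.rfl⟩

theorem Contained.trans {π σ τ : FinPerm} (h : Contained π σ) (h' : Contained σ τ) :
    Contained π τ := by
  obtain ⟨f, hf, hv⟩ := h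
  obtain ⟨g, hg, hw⟩ := h'
  exact ⟨g ∘ f, hg.comp hf, fun a b => (hv a b).trans (hw _ _)⟩

theorem Contained.length_le {π σ : FinPerm} (h : Contained π σ) : π.1 ≤ σ.1 := by
  obtain ⟨f, hf, -⟩ := h
  simpa using Fintype.card_le_of_injective f hf.injective

/-- A strictly monotone self-map of `Fin n` is the identity, and then `σ ∘ π⁻¹` is an order
automorphism of `Fin n`, hence trivial. -/
theorem Contained.eq_of_length_le {π σ : FinPerm} (h : Contained π σ) (hl : σ.1 ≤ π.1) :
    π = σ := by
  have hl' := le_antisymm h.length_le hl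
  obtain ⟨n, π⟩ := π
  obtain ⟨m, σ⟩ := σ
  obtain rfl : n = m := hl'
  obtain ⟨f, hf, hv⟩ := h
  change Fin n → Fin n at f
  obtain rfl : f = id := by
    have : f = (StrictMono.orderIsoOfSurjective f hf
      (Finite.injective_iff_surjective.mp hf.injective)) := rfl
    rw [this, Subsingleton.elim (StrictMono.orderIsoOfSurjective f hf _) (OrderIso.refl _)]
    rfl
  congr 1
  let e : Fin n ≃o Fin n :=
    { toEquiv := π.symm.trans σ
      map_rel_iff' := by
        intro a b
        have := hv (π.symm b) (π.symm a)
        simp only [Equiv.apply_symm_apply, id] at this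
        simp only [Equiv.trans_apply]
        rw [← not_lt, ← not_lt]
        exact not_congr this.symm }
  have he : e = OrderIso.refl _ := Subsingleton.elim _ _
  ext p
  have : e (π p) = π p := by rw [he]; rfl
  change σ (π.symm (π p)) = π p at this
  rw [Equiv.symm_apply_apply] at this
  rw [this]

/-! ### Avoidance classes and finite bases -/

theorem isPermClass_av (B : Set FinPerm) : IsPermClass (Av B) :=
  fun _ _ h hπ β hβ hc => hπ β hβ (hc.trans h)

/-- `B` need not be an antichain: its minimal elements form the basis, and each element lies above a
minimal one by induction on length. -/
theorem finitelyBased_av {B : Set FinPerm} (hB : B.Finite) : FinitelyBased (Av B) := by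
  refine ⟨{β ∈ B | ∀ β' ∈ B, Contained β' β → β' = β}, hB.subset (fun _ h => h.1), ?_, ?_⟩
  · intro β hβ β' hβ' hne hc
    exact hne (hβ'.2 β hβ.1 hc)
  · ext π
    refine ⟨fun h β hβ => h β hβ.1, fun h => ?_⟩
    have key : ∀ n, ∀ β ∈ B, β.1 = n → ¬ Contained β π := by
      intro n
      induction n using Nat.strong_induction_on with
      | _ n ih =>
        intro β hβ hn hc
        refine h β ⟨hβ, fun β' hβ' hc' => ?_⟩ hc
        by_contra hne
        have hlt : β'.1 < n := by
          by_contra hge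
          exact hne (hc'.eq_of_length_le (by omega))
        exact ih _ hlt β' hβ' rfl (hc'.trans hc)
    exact fun β hβ => key _ β hβ rfl

/-! ### Direct sums -/

@[simp] theorem directSum_fst (σ τ : FinPerm) : (directSum σ τ).1 = σ.1 + τ.1 := rfl

theorem val_directSum_left {σ τ : FinPerm} {p : ℕ} (h : p < σ.1) :
    val (directSum σ τ) p = val σ p := by
  have h' : p < σ.1 + τ.1 := by omega
  have : (⟨p, h'⟩ : Fin (σ.1 + τ.1)) = Fin.castAdd τ.1 ⟨p, h⟩ := rfl
  rw [val_of_lt (π := directSum σ τ) h', val_of_lt h]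
  change (finSumFinEquiv.permCongr (Equiv.Perm.sumCongr σ.2 τ.2) ⟨p, h'⟩).1 = _
  rw [this, Equiv.permCongr_apply, finSumFinEquiv_symm_apply_castAdd]
  simp

theorem val_directSum_right {σ τ : FinPerm} {p : ℕ} (h : p < τ.1) :
    val (directSum σ τ) (σ.1 + p) = σ.1 + val τ p := by
  have h' : σ.1 + p < σ.1 + τ.1 := by omega
  have : (⟨σ.1 + p, h'⟩ : Fin (σ.1 + τ.1)) = Fin.natAdd σ.1 ⟨p, h⟩ := rfl
  rw [val_of_lt (π := directSum σ τ) h', val_of_lt h]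
  change (finSumFinEquiv.permCongr (Equiv.Perm.sumCongr σ.2 τ.2) ⟨σ.1 + p, h'⟩).1 = _
  rw [this, Equiv.permCongr_apply, finSumFinEquiv_symm_apply_natAdd]
  simp

theorem contained_directSum_left (σ τ : FinPerm) : Contained σ (directSum σ τ) := by
  refine contained_of id ?_ (fun _ _ h _ => h) ?_
  · intro p hp
    simp only [directSum_fst, id]
    omega
  · intro p q hpq hq
    simp only [id]
    rw [val_directSum_left hq, val_directSum_left (hpq.trans hq)]

theorem contained_directSum_right (σ τ : FinPerm) : Contained τ (directSum σ τ) := by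
  refine contained_of (fun p => σ.1 + p) ?_ (fun _ _ h _ => by omega) ?_
  · intro p hp
    simp only [directSum_fst]
    omega
  · intro p q hpq hq
    rw [val_directSum_right hq, val_directSum_right (hpq.trans hq)]
    omega

/-- `π` is nonempty and not the direct sum of two nonempty permutations. -/
def Indec (π : FinPerm) : Prop :=
  0 < π.1 ∧ ∀ k, 0 < k → k < π.1 → ∃ p < k, k ≤ val π p

/-- A copy of `β` meeting both summands would itself be split as a direct sum at the point where it
crosses over. -/
theorem Indec.contained_directSum {β σ τ : FinPerm} (hβ : Indec β)
    (h : Contained β (directSum σ τ)) : Contained β σ ∨ Contained β τ := by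
  obtain ⟨f, hf, hm, hv⟩ := h.exists_fun
  simp only [directSum_fst] at hf
  have hleft : ∀ p, f p < σ.1 → val (directSum σ τ) (f p) = val σ (f p) :=
    fun p hp => val_directSum_left hp
  have hright : ∀ p < β.1, σ.1 ≤ f p →
      val (directSum σ τ) (f p) = σ.1 + val τ (f p - σ.1) := by
    intro p hp h
    have := val_directSum_right (σ := σ) (τ := τ) (p := f p - σ.1) (by have := hf p hp; omega)
    rwa [Nat.add_sub_cancel' h] at this
  by_cases h0 : ∃ p < β.1, σ.1 ≤ f p
  · classical
    right
    -- `k` is the first position of `β` that is sent into `τ`; the claim below is that `k = 0`.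
    obtain ⟨k, ⟨hk1, hk2⟩, hk3⟩ : ∃ k, (k < β.1 ∧ σ.1 ≤ f k) ∧ ∀ p < k, f p < σ.1 := by
      refine ⟨Nat.find h0, Nat.find_spec h0, fun p hp => ?_⟩
      have h1 := Nat.find_min h0 hp
      have h2 := (Nat.find_spec h0).1
      by_contra hc
      exact h1 ⟨by omega, by omega⟩
    have hk4 : ∀ p, k ≤ p → p < β.1 → σ.1 ≤ f p := fun p h1 h2 => by
      rcases h1.eq_or_lt with rfl | h1
      · exact hk2
      · exact hk2.trans (hm _ _ h1 h2).le
    have hk : k = 0 := by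
      by_contra hk0
      obtain ⟨p, hp, hpv⟩ := hβ.2 k (by omega) hk1
      have hlow : ∀ q, k ≤ q → q < β.1 → val β p < val β q := by
        intro q h1 h2
        rw [hv p q (by omega) h2, hleft p (hk3 p hp), hright q h2 (hk4 q h1 h2)]
        have := val_lt (hk3 p hp)
        omega
      -- Pigeonhole: all the values up to `val β p ≥ k` would have to occur among the first `k`
      -- positions.
      have hsub : (Finset.range (val β p + 1)) ⊆ (Finset.range k).image (val β) := by
        intro y hy
        simp only [Finset.mem_range] at hy
        have hpn := val_lt (π := β) (p := p) (by omega)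
        obtain ⟨q, hq, rfl⟩ := exists_val_eq (π := β) (y := y) (by omega)
        simp only [Finset.mem_image, Finset.mem_range]
        refine ⟨q, ?_, rfl⟩
        by_contra hc
        have := hlow q (by omega) hq
        omega
      have h1 := Finset.card_le_card hsub
      have h2 := Finset.card_image_le (s := Finset.range k) (f := val β)
      simp only [Finset.card_range] at h1 h2
      omega
    refine contained_of (fun p => f p - σ.1) ?_ ?_ ?_
    · intro p hp
      have := hf p hp
      have := hk4 p (by omega) hp
      omega
    · intro p q hpq hq
      have := hm p q hpq hq
      have := hk4 p (by omega) (by omega)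
      omega
    · intro p q hpq hq
      rw [hv p q (by omega) hq, hright p (by omega) (hk4 p (by omega) (by omega)),
        hright q hq (hk4 q (by omega) (by omega))]
      omega
  · push Not at h0
    left
    refine contained_of f h0 hm ?_
    intro p q hpq hq
    rw [hv p q (by omega) hq, hleft p (h0 p (by omega)), hleft q (h0 q hq)]

theorem directSum_mem_av_iff {B : Set FinPerm} (hB : ∀ β ∈ B, Indec β) (σ τ : FinPerm) :
    directSum σ τ ∈ Av B ↔ σ ∈ Av B ∧ τ ∈ Av B := by
  refine ⟨fun h => ⟨isPermClass_av B _ _ (contained_directSum_left σ τ) h,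
    isPermClass_av B _ _ (contained_directSum_right σ τ) h⟩, fun h β hβ hc => ?_⟩
  rcases (hB β hβ).contained_directSum hc with h' | h'
  · exact h.1 β hβ h'
  · exact h.2 β hβ h'

/-- The first `k` positions already use up all `k` values below `k`. -/
theorem val_ge_of_prefix {π : FinPerm} {k : ℕ} (hk : ∀ p < k, val π p < k)
    {p : ℕ} (hp : k ≤ p) (hpn : p < π.1) : k ≤ val π p := by
  by_contra hc
  have hsurj : Finset.image (val π) (Finset.range k) = Finset.range k := by
    apply Finset.eq_of_subset_of_card_le
    · intro y
      simp only [Finset.mem_image, Finset.mem_range]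
      rintro ⟨q, hq, rfl⟩
      exact hk q hq
    · rw [Finset.card_image_of_injOn]
      intro a ha b hb he
      simp only [Finset.coe_range, Set.mem_Iio] at ha hb
      exact val_inj (by omega) (by omega) he
  have : val π p ∈ Finset.image (val π) (Finset.range k) := by
    rw [hsurj]
    simp only [Finset.mem_range]
    omega
  simp only [Finset.mem_image, Finset.mem_range] at this
  obtain ⟨q, hq, he⟩ := this
  have := val_inj (by omega) hpn he
  omega

theorem exists_directSum {π : FinPerm} (h : 0 < π.1) :
    ∃ σ τ, Indec σ ∧ directSum σ τ = π := by
  classical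
  -- The first summand is the shortest nonempty prefix that maps to itself; minimality makes it
  -- indecomposable.
  obtain ⟨k, ⟨hk0, hkn, hk⟩, hmin⟩ : ∃ k, (0 < k ∧ k ≤ π.1 ∧ ∀ p < k, val π p < k) ∧
      ∀ j, 0 < j → j < k → ∃ p < j, j ≤ val π p := by
    have hex : ∃ k, 0 < k ∧ k ≤ π.1 ∧ ∀ p < k, val π p < k :=
      ⟨π.1, h, le_rfl, fun p hp => val_lt hp⟩
    refine ⟨Nat.find hex, Nat.find_spec hex, fun j hj0 hjk => ?_⟩
    have h1 := Nat.find_min hex hjk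
    have h2 := (Nat.find_spec hex).2.1
    by_contra hc
    push Not at hc
    exact h1 ⟨hj0, by omega, hc⟩
  have hinj : ∀ p q, p < q → q < π.1 → val π p ≠ val π q := fun p q hpq hq he => by
    have := val_inj (hpq.trans hq) hq he
    omega
  have hup : ∀ p, k ≤ p → p < π.1 → k ≤ val π p := fun p => val_ge_of_prefix hk
  obtain ⟨σ, hσ, hσv⟩ : ∃ σ : FinPerm, σ.1 = k ∧ ∀ p < k, val σ p = val π p :=
    ⟨ofFun k (val π) hk fun p q hpq hq => hinj p q hpq (by omega), rfl, fun p hp => val_ofFun hp⟩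
  obtain ⟨τ, hτ, hτv⟩ : ∃ τ : FinPerm, τ.1 = π.1 - k ∧
      ∀ p < π.1 - k, val τ p = val π (k + p) - k := by
    refine ⟨ofFun (π.1 - k) (fun p => val π (k + p) - k) (fun p hp => ?_) (fun p q hpq hq he => ?_),
      rfl, fun p hp => val_ofFun hp⟩
    · have := val_lt (π := π) (p := k + p) (by omega)
      omega
    · have h1 := hup (k + p) (by omega) (by omega)
      have h2 := hup (k + q) (by omega) (by omega)
      exact hinj (k + p) (k + q) (by omega) (by omega) (by omega)
  refine ⟨σ, τ, ⟨by omega, fun j hj0 hjk => ?_⟩, ext_val ?_ ?_⟩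
  · obtain ⟨p, hp, hpv⟩ := hmin j hj0 (by omega)
    exact ⟨p, hp, by rwa [hσv p (by omega)]⟩
  · simp only [directSum_fst]
    omega
  · intro p hp
    simp only [directSum_fst] at hp
    by_cases hpk : p < k
    · rw [val_directSum_left (by omega), hσv p hpk]
    · obtain ⟨q, rfl⟩ : ∃ q, p = σ.1 + q := ⟨p - k, by omega⟩
      rw [val_directSum_right (by omega), hτv q (by omega), hσ]
      have := hup (k + q) (by omega) (by omega)
      omega

/-- If `σ'` were longer, one of its entries would cross the end of `σ`, where the sum is cut. -/
theorem directSum_length_le {σ τ σ' τ' : FinPerm} (hσ : Indec σ) (hσ' : Indec σ')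
    (h : directSum σ τ = directSum σ' τ') : σ'.1 ≤ σ.1 := by
  by_contra hc
  obtain ⟨p, hp, hpv⟩ := hσ'.2 σ.1 hσ.1 (by omega)
  rw [← val_directSum_left (τ := τ') (show p < σ'.1 by omega), ← h, val_directSum_left hp] at hpv
  have := val_lt hp
  omega

theorem directSum_inj {σ τ σ' τ' : FinPerm} (hσ : Indec σ) (hσ' : Indec σ')
    (h : directSum σ τ = directSum σ' τ') : σ = σ' ∧ τ = τ' := by
  have hl := le_antisymm (directSum_length_le hσ' hσ h.symm) (directSum_length_le hσ hσ' h)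
  have hl2 : τ.1 = τ'.1 := by
    have := congrArg Sigma.fst h
    simp only [directSum_fst] at this
    omega
  obtain rfl : σ = σ' := ext_val hl fun p hp => by
    rw [← val_directSum_left (τ := τ) hp, h, val_directSum_left (by omega)]
  refine ⟨rfl, ext_val hl2 fun p hp => ?_⟩
  have h1 := val_directSum_right (σ := σ) hp
  rw [h, val_directSum_right (by omega)] at h1
  omega

/-! ### Counting -/

theorem finite_length (n : ℕ) : {π : FinPerm | π.1 = n}.Finite := by
  refine (Set.finite_range (fun p : Equiv.Perm (Fin n) => (⟨n, p⟩ : FinPerm))).subset ?_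
  rintro ⟨m, π⟩ rfl
  exact ⟨π, rfl⟩

theorem count_eq_ncard (C : Set FinPerm) (n : ℕ) :
    count C n = {π : FinPerm | π ∈ C ∧ π.1 = n}.ncard := by
  have hinj : Function.Injective (fun π : Equiv.Perm (Fin n) => (⟨n, π⟩ : FinPerm)) :=
    sigma_mk_injective (β := fun n => Equiv.Perm (Fin n))
  rw [count, ← Set.ncard_image_of_injective _ hinj]
  congr 1
  ext ⟨m, π⟩
  constructor
  · rintro ⟨p, hp, he⟩
    obtain ⟨rfl, he⟩ := Sigma.mk.inj_iff.mp he
    cases he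
    exact ⟨hp, rfl⟩
  · rintro ⟨h, rfl⟩
    exact ⟨π, h, rfl⟩

/-- The number of sum indecomposable members of length `n`. -/
noncomputable def indecCount (C : Set FinPerm) (n : ℕ) : ℕ :=
  {π : FinPerm | (Indec π ∧ π ∈ C) ∧ π.1 = n}.ncard

theorem indecCount_zero (C : Set FinPerm) : indecCount C 0 = 0 := by
  rw [indecCount, Set.ncard_eq_zero ((finite_length 0).subset fun _ h => h.2)]
  ext π
  simp only [Set.mem_ofPred_eq, Set.mem_empty_iff_false, iff_false]
  rintro ⟨⟨h, -⟩, h0⟩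
  have := h.1
  omega

theorem empty_mem_av {B : Set FinPerm} (hB : ∀ β ∈ B, Indec β) {π : FinPerm} (hπ : π.1 = 0) :
    π ∈ Av B := fun β hβ hc => by
  have h1 := (hB β hβ).1
  have h2 := hc.length_le
  omega

theorem count_av_zero {B : Set FinPerm} (hB : ∀ β ∈ B, Indec β) : count (Av B) 0 = 1 := by
  rw [count_eq_ncard, Set.ncard_eq_one]
  refine ⟨⟨0, 1⟩, ?_⟩
  ext π
  simp only [Set.mem_ofPred_eq, Set.mem_singleton_iff]
  constructor
  · rintro ⟨-, h⟩
    exact ext_val h (fun p hp => by omega)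
  · rintro rfl
    exact ⟨empty_mem_av hB rfl, rfl⟩

/-- Splitting off the first indecomposable summand is a bijection onto pairs (indecomposable member,
member). -/
theorem count_av {B : Set FinPerm} (hB : ∀ β ∈ B, Indec β) {n : ℕ} (hn : 0 < n) :
    count (Av B) n =
      ∑ x ∈ Finset.HasAntidiagonal.antidiagonal n, indecCount (Av B) x.1 * count (Av B) x.2 := by
  classical
  have hT : ∀ n, {π : FinPerm | π ∈ Av B ∧ π.1 = n}.Finite :=
    fun n => (finite_length n).subset fun _ h => h.2
  have hS : ∀ n, {π : FinPerm | (Indec π ∧ π ∈ Av B) ∧ π.1 = n}.Finite :=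
    fun n => (finite_length n).subset fun _ h => h.2
  simp only [count_eq_ncard, indecCount]
  simp_rw [Set.ncard_eq_toFinset_card _ (hT _), Set.ncard_eq_toFinset_card _ (hS _),
    ← Finset.card_product]
  rw [← Finset.card_sigma]
  symm
  refine Finset.card_bij (fun x _ => directSum x.2.1 x.2.2) ?_ ?_ ?_
  · rintro ⟨⟨a, b⟩, σ, τ⟩ h
    simp only [Finset.mem_sigma, Finset.HasAntidiagonal.mem_antidiagonal, Finset.mem_product,
      Set.Finite.mem_toFinset, Set.mem_ofPred_eq] at h ⊢
    obtain ⟨rfl, ⟨⟨-, h1⟩, rfl⟩, h2, rfl⟩ := h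
    exact ⟨(directSum_mem_av_iff hB _ _).mpr ⟨h1, h2⟩, rfl⟩
  · rintro ⟨⟨a, b⟩, σ, τ⟩ h ⟨⟨a', b'⟩, σ', τ'⟩ h' he
    simp only [Finset.mem_sigma, Finset.HasAntidiagonal.mem_antidiagonal, Finset.mem_product,
      Set.Finite.mem_toFinset, Set.mem_ofPred_eq] at h h' he
    obtain ⟨-, ⟨⟨h1, -⟩, rfl⟩, -, rfl⟩ := h
    obtain ⟨-, ⟨⟨h1', -⟩, rfl⟩, -, rfl⟩ := h'
    obtain ⟨rfl, rfl⟩ := directSum_inj h1 h1' he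
    rfl
  · intro π hπ
    simp only [Set.Finite.mem_toFinset, Set.mem_ofPred_eq] at hπ
    obtain ⟨hπ, rfl⟩ := hπ
    obtain ⟨σ, τ, hσ, rfl⟩ := exists_directSum hn
    have := (directSum_mem_av_iff hB _ _).mp hπ
    exact ⟨⟨(σ.1, τ.1), σ, τ⟩, by simp [hσ, this.1, this.2], rfl⟩

/-! ### From a convolution recurrence to a growth rate -/

/-- Growth of a sequence given by a convolution recurrence: the tails `t` of the kernel, rescaled by
powers of `γ`, satisfy `∑ t a * c b = γ ^ n`. -/
theorem tendsto_of_renewal {c s t : ℕ → ℝ} {γ K : ℝ} (hγ : 0 < γ) (hc0 : c 0 = 1)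
    (hc : ∀ n, 0 < n → c n = ∑ x ∈ Finset.HasAntidiagonal.antidiagonal n, s x.1 * c x.2)
    (hcn : ∀ n, 0 ≤ c n) (hs0 : s 0 = 0) (hs1 : s 1 = 1) (hs : ∀ n, 0 ≤ s n)
    (ht0 : t 0 = 1) (ht : ∀ n, t (n + 1) = γ * t n - s (n + 1)) (htn : ∀ n, 0 ≤ t n)
    (htK : ∀ n, t n ≤ K) :
    Tendsto (fun n : ℕ => c n ^ ((1 : ℝ) / (n : ℝ))) atTop (𝓝 γ) := by
  have hK : 1 ≤ K := ht0 ▸ htK 0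
  have hR : ∀ n, ∑ x ∈ Finset.HasAntidiagonal.antidiagonal n, t x.1 * c x.2 = γ ^ n := by
    intro n
    induction n with
    | zero => simp [ht0, hc0]
    | succ n ih =>
      have h := hc (n + 1) (by omega)
      rw [Finset.Nat.sum_antidiagonal_succ] at h ⊢
      simp only [hs0, zero_mul, zero_add] at h
      rw [ht0, one_mul, h, ← Finset.sum_add_distrib, pow_succ, ← ih, Finset.sum_mul]
      refine Finset.sum_congr rfl fun x _ => ?_
      rw [ht]
      ring
  -- The term with `s 1 = 1` alone already contributes `c n` to `c (n + 1)`.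
  have hmono : Monotone c := by
    refine monotone_nat_of_le_succ fun n => ?_
    rw [hc (n + 1) (by omega)]
    calc c n = s 1 * c n := by rw [hs1, one_mul]
      _ ≤ _ := Finset.single_le_sum (f := fun x : ℕ × ℕ => s x.1 * c x.2)
        (fun x _ => mul_nonneg (hs _) (hcn _))
        (show (1, n) ∈ Finset.HasAntidiagonal.antidiagonal (n + 1) by simp [add_comm])
  have hup : ∀ n, c n ≤ γ ^ n := by
    intro n
    rw [← hR]
    calc c n = t 0 * c n := by rw [ht0, one_mul]
      _ ≤ _ := Finset.single_le_sum (f := fun x : ℕ × ℕ => t x.1 * c x.2)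
        (fun x _ => mul_nonneg (htn _) (hcn _))
        (show (0, n) ∈ Finset.HasAntidiagonal.antidiagonal n by simp)
  -- Each of the `n + 1` terms of the sum equal to `γ ^ n` is at most `K * c n`.
  have hlow : ∀ n : ℕ, γ ^ n / (K * (n + 1)) ≤ c n := by
    intro n
    rw [div_le_iff₀ (by positivity), ← hR]
    calc ∑ x ∈ Finset.HasAntidiagonal.antidiagonal n, t x.1 * c x.2
        ≤ ∑ x ∈ Finset.HasAntidiagonal.antidiagonal n, K * c n := by
          refine Finset.sum_le_sum fun x hx => ?_
          refine mul_le_mul (htK _) (hmono ?_) (hcn _) (by linarith)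
          have := Finset.HasAntidiagonal.mem_antidiagonal.mp hx
          omega
      _ = c n * (K * (n + 1)) := by
          rw [Finset.sum_const, Finset.Nat.card_antidiagonal, nsmul_eq_mul]
          push_cast
          ring
  have hlim : Tendsto (fun n : ℕ => γ / ((K * ((n : ℝ) + 1)) ^ ((1 : ℝ) / (n : ℝ)))) atTop
      (𝓝 (γ / (1 * 1))) := by
    refine tendsto_const_nhds.div ?_ (by norm_num)
    have h1 : Tendsto (fun n : ℕ => K ^ ((1 : ℝ) / (n : ℝ))) atTop (𝓝 1) := by
      have := (tendsto_const_nhds (x := K) (f := atTop)).rpow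
        (tendsto_one_div_atTop_nhds_zero_nat (𝕜 := ℝ)) (Or.inl (by linarith))
      simpa using this
    have h2 : Tendsto (fun n : ℕ => ((n : ℝ) + 1) ^ ((1 : ℝ) / (n : ℝ))) atTop (𝓝 1) := by
      -- This is the limit of `x ^ (1 / (x - 1))`, taken along `x = n + 1`.
      have h := (tendsto_rpow_div_mul_add 1 1 (-1) (by norm_num)).comp
        (tendsto_atTop_add_const_right _ (1 : ℝ) (tendsto_natCast_atTop_atTop (R := ℝ)))
      refine h.congr fun n => ?_
      simp
    refine (h1.mul h2).congr fun n => ?_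
    rw [Real.mul_rpow (by linarith) (by positivity)]
  rw [mul_one, div_one] at hlim
  have hpow : ∀ n : ℕ, 0 < n → (γ ^ n) ^ ((1 : ℝ) / (n : ℝ)) = γ := by
    intro n hn
    rw [one_div, Real.pow_rpow_inv_natCast hγ.le (by omega)]
  refine tendsto_of_tendsto_of_tendsto_of_le_of_le' hlim tendsto_const_nhds ?_ ?_
  · filter_upwards [eventually_gt_atTop 0] with n hn
    calc γ / ((K * ((n : ℝ) + 1)) ^ ((1 : ℝ) / (n : ℝ)))
        = (γ ^ n / (K * (n + 1))) ^ ((1 : ℝ) / (n : ℝ)) := by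
          rw [Real.div_rpow (by positivity) (by positivity), hpow n hn]
      _ ≤ _ := Real.rpow_le_rpow (by positivity) (hlow n) (by positivity)
  · filter_upwards [eventually_gt_atTop 0] with n hn
    calc _ ≤ (γ ^ n) ^ ((1 : ℝ) / (n : ℝ)) :=
          Real.rpow_le_rpow (hcn n) (hup n) (by positivity)
      _ = γ := hpow n hn

/-- The recurrence forces `t n = γ ^ n - ∑ s k * γ ^ (n - k)` over `1 ≤ k ≤ n`. A bound on `t` thus
encodes `∑ s k * γ ^ (-k) = 1`; users supply `t` in closed form. -/
theorem hasGrowthRate_av {B : Set FinPerm} (hB : ∀ β ∈ B, Indec β) {s : ℕ → ℕ}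
    (hs : ∀ n, 0 < n → indecCount (Av B) n = s n) (hs0 : s 0 = 0) (hs1 : s 1 = 1)
    {t : ℕ → ℝ} {γ K : ℝ} (hγ : 0 < γ) (ht0 : t 0 = 1)
    (ht : ∀ n, t (n + 1) = γ * t n - s (n + 1)) (htn : ∀ n, 0 ≤ t n) (htK : ∀ n, t n ≤ K) :
    HasGrowthRate (Av B) γ := by
  have hs' : ∀ n, indecCount (Av B) n = s n := fun n => by
    rcases Nat.eq_zero_or_pos n with rfl | h
    · rw [indecCount_zero, hs0]
    · exact hs n h
  refine tendsto_of_renewal (c := fun n => (count (Av B) n : ℝ)) (s := fun n => (s n : ℝ)) hγ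
    (by simp [count_av_zero hB]) (fun n hn => ?_) (fun n => Nat.cast_nonneg _) (by simp [hs0])
    (by simp [hs1]) (fun n => Nat.cast_nonneg _) ht0 ht htn htK
  rw [count_av hB hn]
  simp [hs']

/-! ### The polynomials -/

theorem quintic_neg {x : ℝ} (h0 : 0 < x) (h : x ≤ 2) : x ^ 5 - 2 * x ^ 4 - x ^ 2 - x - 1 < 0 := by
  have : x ^ 4 * (x - 2) ≤ 0 := mul_nonpos_of_nonneg_of_nonpos (by positivity) (by linarith)
  nlinarith [sq_nonneg x]

/-- The Taylor coefficients of the quintic at 2 are positive in every positive degree, the linear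
one being 11. After the shift by 2 the difference is a polynomial in `a` and `d` with nonnegative
coefficients. -/
theorem quintic_sub_le {x y : ℝ} (hx : 2 ≤ x) (h : x ≤ y) :
    y - x ≤ (y ^ 5 - 2 * y ^ 4 - y ^ 2 - y - 1) - (x ^ 5 - 2 * x ^ 4 - x ^ 2 - x - 1) := by
  obtain ⟨a, rfl⟩ : ∃ a, x = a + 2 := ⟨x - 2, by ring⟩
  obtain ⟨d, rfl⟩ : ∃ d, y = a + 2 + d := ⟨y - (a + 2), by ring⟩
  have ha : 0 ≤ a := by linarith
  have hd : 0 ≤ d := by linarith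
  ring_nf
  nlinarith [show 0 ≤ a * d by positivity, show 0 ≤ a ^ 2 * d by positivity,
    show 0 ≤ a ^ 3 * d by positivity, show 0 ≤ a ^ 4 * d by positivity,
    show 0 ≤ d ^ 2 by positivity, show 0 ≤ a * d ^ 2 by positivity,
    show 0 ≤ a ^ 2 * d ^ 2 by positivity, show 0 ≤ a ^ 3 * d ^ 2 by positivity,
    show 0 ≤ d ^ 3 by positivity, show 0 ≤ a * d ^ 3 by positivity,
    show 0 ≤ a ^ 2 * d ^ 3 by positivity, show 0 ≤ d ^ 4 by positivity,
    show 0 ≤ a * d ^ 4 by positivity, show 0 ≤ d ^ 5 by positivity]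

theorem exists_quintic_root : ∃ ξ : ℝ, 2.30521 < ξ ∧ ξ < 2.30523 ∧
    ξ ^ 5 - 2 * ξ ^ 4 - ξ ^ 2 - ξ - 1 = 0 := by
  have hc : ContinuousOn (fun x : ℝ => x ^ 5 - 2 * x ^ 4 - x ^ 2 - x - 1)
      (Set.Icc 2.30521 2.30523) := by fun_prop
  obtain ⟨x, hx, h⟩ := intermediate_value_Ioo (by norm_num) hc
    (show (0 : ℝ) ∈ Set.Ioo _ _ by constructor <;> norm_num)
  exact ⟨x, hx.1, hx.2, h⟩

theorem quintic_root_unique {ξ : ℝ} (h2 : 2 ≤ ξ) (hξ : ξ ^ 5 - 2 * ξ ^ 4 - ξ ^ 2 - ξ - 1 = 0)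
    (x : ℝ) : (0 < x ∧ x ^ 5 - 2 * x ^ 4 - x ^ 2 - x - 1 = 0) ↔ x = ξ := by
  constructor
  · rintro ⟨h0, h⟩
    have hx : 2 < x := by
      by_contra hc
      have := quintic_neg h0 (by linarith)
      linarith
    rcases le_total x ξ with g | g
    · have := quintic_sub_le hx.le g
      linarith
    · have := quintic_sub_le h2 g
      linarith
  · rintro rfl
    exact ⟨by linarith, hξ⟩

theorem exists_greatest_root {ξ : ℝ} (h2 : 2 ≤ ξ)
    (hξ : ξ ^ 5 - 2 * ξ ^ 4 - ξ ^ 2 - ξ - 1 = 0) (i : ℕ) :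
    ∃ γ : ℝ, ξ < γ ∧ γ ≤ ξ + (1 / 2) ^ i ∧ IsGreatest
      {x : ℝ | (x ^ 5 - 2 * x ^ 4 - x ^ 2 - x - 1) * (x + 1) * x ^ (2 * i + 3) - 1 = 0} γ := by
  have hpos : ∀ x, ξ ≤ x → x - ξ ≤ x ^ 5 - 2 * x ^ 4 - x ^ 2 - x - 1 := fun x hx => by
    have := quintic_sub_le h2 hx
    linarith
  -- This makes the function nonnegative at `ξ + (1 / 2) ^ i`; at `ξ` it equals `-1`, so a root lies
  -- between.
  have hmul : ∀ x, ξ ≤ x → (x - ξ) * 2 ^ i ≤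
      (x ^ 5 - 2 * x ^ 4 - x ^ 2 - x - 1) * (x + 1) * x ^ (2 * i + 3) := by
    intro x hx
    have h1 : (2 : ℝ) ^ i ≤ x ^ (2 * i + 3) :=
      calc (2 : ℝ) ^ i ≤ 2 ^ (2 * i + 3) := pow_le_pow_right₀ (by norm_num) (by omega)
        _ ≤ _ := pow_le_pow_left₀ (by norm_num) (by linarith) _
    have h3 := hpos x hx
    have h4 : x - ξ ≤ (x ^ 5 - 2 * x ^ 4 - x ^ 2 - x - 1) * (x + 1) := by nlinarith
    exact mul_le_mul h4 h1 (by positivity) (by linarith)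
  have hc : ContinuousOn
      (fun x : ℝ => (x ^ 5 - 2 * x ^ 4 - x ^ 2 - x - 1) * (x + 1) * x ^ (2 * i + 3) - 1)
      (Set.Icc ξ (ξ + (1 / 2) ^ i)) := by fun_prop
  have hd : (0 : ℝ) < (1 / 2) ^ i := by positivity
  obtain ⟨γ, hγ, h⟩ := intermediate_value_Icc (by linarith) hc (show (0 : ℝ) ∈ Set.Icc _ _ by
    constructor
    · simp [hξ]
    · have := hmul (ξ + (1 / 2) ^ i) (by linarith)
      have e : (ξ + (1 / 2 : ℝ) ^ i - ξ) * 2 ^ i = 1 := by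
        rw [add_sub_cancel_left, ← mul_pow]
        norm_num
      linarith)
  simp only at h
  have hne : ξ ≠ γ := by
    rintro rfl
    rw [hξ] at h
    norm_num at h
  have hlt : ξ < γ := lt_of_le_of_ne hγ.1 hne
  refine ⟨γ, hlt, hγ.2, h, fun x hx => ?_⟩
  simp only [Set.mem_ofPred_eq] at hx
  by_contra hc
  push Not at hc
  have h1 := quintic_sub_le (h2.trans hγ.1) hc.le
  have h3 := hpos γ hγ.1
  -- To the right of `γ` all factors are positive and increasing, so no further root exists.
  have h4 : (γ ^ 5 - 2 * γ ^ 4 - γ ^ 2 - γ - 1) * (γ + 1) <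
      (x ^ 5 - 2 * x ^ 4 - x ^ 2 - x - 1) * (x + 1) :=
    mul_lt_mul'' (by linarith) (by linarith) (by linarith) (by linarith)
  have h5 : γ ^ (2 * i + 3) < x ^ (2 * i + 3) := pow_lt_pow_left₀ hc (by linarith) (by omega)
  have h6 := mul_lt_mul'' h4 h5 (mul_nonneg (by linarith) (by linarith))
    (pow_nonneg (by linarith) _)
  linarith

/-! ### Small patterns -/

/-- The permutation with a given list of values. -/
noncomputable def ofList (l : List ℕ) (h : ∀ p < l.length, l.getD p 0 < l.length)
    (hi : ∀ q < l.length, ∀ p < q, l.getD p 0 ≠ l.getD q 0) : FinPerm :=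
  ofFun l.length (fun p => l.getD p 0) h (fun p q hpq hq => hi q hq p hpq)

/-- Bounded quantifiers over list positions let `simp` unfold a concrete pattern into linear
inequalities for `omega`. -/
theorem contained_ofList_iff {l : List ℕ} {h hi} {π : FinPerm} :
    Contained (ofList l h hi) π ↔ ∃ f : ℕ → ℕ, (∀ p < l.length, f p < π.1) ∧
      ∀ q < l.length, ∀ p < q, f p < f q ∧
        (l.getD p 0 < l.getD q 0 → val π (f p) < val π (f q)) ∧
        (l.getD q 0 < l.getD p 0 → val π (f q) < val π (f p)) := by
  have hval : ∀ p < l.length, val (ofList l h hi) p = l.getD p 0 := fun p hp => val_ofFun hp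
  constructor
  · intro hc
    obtain ⟨f, hf, hm, hv⟩ := hc.exists_fun
    refine ⟨f, hf, fun q hq p hpq => ⟨hm p q hpq hq, fun hlt => ?_, fun hlt => ?_⟩⟩
    · rwa [← hv p q (hpq.trans hq) hq, hval p (hpq.trans hq), hval q hq]
    · rwa [← hv q p hq (hpq.trans hq), hval p (hpq.trans hq), hval q hq]
  · rintro ⟨f, hf, hv⟩
    refine contained_of f hf (fun p q hpq hq => (hv q hq p hpq).1) fun p q hpq hq => ?_
    obtain ⟨-, h1, h2⟩ := hv q hq p hpq
    rw [hval p (hpq.trans hq), hval q hq]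
    have := hi q hq p hpq
    omega

theorem indec_ofList {l : List ℕ} {h hi} (hl : 0 < l.length)
    (hp : ∀ k < l.length, 0 < k → ∃ p < k, k ≤ l.getD p 0) : Indec (ofList l h hi) := by
  refine ⟨hl, fun k hk hkl => ?_⟩
  obtain ⟨p, hpk, hv⟩ := hp k hkl hk
  have : val (ofList l h hi) p = l.getD p 0 := val_ofFun (hpk.trans hkl)
  exact ⟨p, hpk, by omega⟩

/-- The permutation `321`. -/
noncomputable def perm321 : FinPerm := ofList [2, 1, 0] (by decide) (by decide)

theorem contained_perm321_iff {π : FinPerm} : Contained perm321 π ↔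
    ∃ a b c, (a < b ∧ b < c ∧ c < π.1) ∧
      val π c < val π b ∧ val π b < val π a := by
  rw [perm321, contained_ofList_iff]
  constructor
  · rintro ⟨f, hf, hv⟩
    simp only [List.length_cons, List.length_nil, Nat.forall_lt_succ_right] at hf hv
    simp at hf hv
    exact ⟨f 0, f 1, f 2, by omega, by omega⟩
  · rintro ⟨a, b, c, hm, hv⟩
    refine ⟨fun p => [a, b, c].getD p 0, ?_⟩
    simp only [List.length_cons, List.length_nil, Nat.forall_lt_succ_right]
    simp
    omega

theorem indec_perm321 : Indec perm321 := indec_ofList (by decide) (by decide)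

/-- The permutation `4123`. -/
noncomputable def perm4123 : FinPerm := ofList [3, 0, 1, 2] (by decide) (by decide)

theorem contained_perm4123_iff {π : FinPerm} : Contained perm4123 π ↔
    ∃ a b c d, (a < b ∧ b < c ∧ c < d ∧ d < π.1) ∧
      val π b < val π c ∧ val π c < val π d ∧ val π d < val π a := by
  rw [perm4123, contained_ofList_iff]
  constructor
  · rintro ⟨f, hf, hv⟩
    simp only [List.length_cons, List.length_nil, Nat.forall_lt_succ_right] at hf hv
    simp at hf hv
    exact ⟨f 0, f 1, f 2, f 3, by omega, by omega⟩
  · rintro ⟨a, b, c, d, hm, hv⟩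
    refine ⟨fun p => [a, b, c, d].getD p 0, ?_⟩
    simp only [List.length_cons, List.length_nil, Nat.forall_lt_succ_right]
    simp
    omega

theorem indec_perm4123 : Indec perm4123 := indec_ofList (by decide) (by decide)

/-- The permutation `3412`. -/
noncomputable def perm3412 : FinPerm := ofList [2, 3, 0, 1] (by decide) (by decide)

theorem contained_perm3412_iff {π : FinPerm} : Contained perm3412 π ↔
    ∃ a b c d, (a < b ∧ b < c ∧ c < d ∧ d < π.1) ∧
      val π c < val π d ∧ val π d < val π a ∧ val π a < val π b := by
  rw [perm3412, contained_ofList_iff]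
  constructor
  · rintro ⟨f, hf, hv⟩
    simp only [List.length_cons, List.length_nil, Nat.forall_lt_succ_right] at hf hv
    simp at hf hv
    exact ⟨f 0, f 1, f 2, f 3, by omega, by omega⟩
  · rintro ⟨a, b, c, d, hm, hv⟩
    refine ⟨fun p => [a, b, c, d].getD p 0, ?_⟩
    simp only [List.length_cons, List.length_nil, Nat.forall_lt_succ_right]
    simp
    omega

theorem indec_perm3412 : Indec perm3412 := indec_ofList (by decide) (by decide)

/-- The permutation `314625`. -/
noncomputable def perm314625 : FinPerm := ofList [2, 0, 3, 5, 1, 4] (by decide) (by decide)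

theorem contained_perm314625_iff {π : FinPerm} : Contained perm314625 π ↔
    ∃ a b c d e f, (a < b ∧ b < c ∧ c < d ∧ d < e ∧ e < f ∧ f < π.1) ∧
      val π b < val π e ∧ val π e < val π a ∧ val π a < val π c ∧ val π c < val π f ∧
        val π f < val π d := by
  rw [perm314625, contained_ofList_iff]
  constructor
  · rintro ⟨f, hf, hv⟩
    simp only [List.length_cons, List.length_nil, Nat.forall_lt_succ_right] at hf hv
    simp at hf hv
    exact ⟨f 0, f 1, f 2, f 3, f 4, f 5, by omega, by omega⟩
  · rintro ⟨a, b, c, d, e, f, hm, hv⟩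
    refine ⟨fun p => [a, b, c, d, e, f].getD p 0, ?_⟩
    simp only [List.length_cons, List.length_nil, Nat.forall_lt_succ_right]
    simp
    omega

theorem indec_perm314625 : Indec perm314625 := indec_ofList (by decide) (by decide)

/-- The permutation `23451`. -/
noncomputable def perm23451 : FinPerm := ofList [1, 2, 3, 4, 0] (by decide) (by decide)

theorem contained_perm23451_iff {π : FinPerm} : Contained perm23451 π ↔
    ∃ a b c d e, (a < b ∧ b < c ∧ c < d ∧ d < e ∧ e < π.1) ∧
      val π e < val π a ∧ val π a < val π b ∧ val π b < val π c ∧ val π c < val π d := by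
  rw [perm23451, contained_ofList_iff]
  constructor
  · rintro ⟨f, hf, hv⟩
    simp only [List.length_cons, List.length_nil, Nat.forall_lt_succ_right] at hf hv
    simp at hf hv
    exact ⟨f 0, f 1, f 2, f 3, f 4, by omega, by omega⟩
  · rintro ⟨a, b, c, d, e, hm, hv⟩
    refine ⟨fun p => [a, b, c, d, e].getD p 0, ?_⟩
    simp only [List.length_cons, List.length_nil, Nat.forall_lt_succ_right]
    simp
    omega

theorem indec_perm23451 : Indec perm23451 := indec_ofList (by decide) (by decide)

/-- The permutation `2413`. -/
noncomputable def perm2413 : FinPerm := ofList [1, 3, 0, 2] (by decide) (by decide)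

theorem contained_perm2413_iff {π : FinPerm} : Contained perm2413 π ↔
    ∃ a b c d, (a < b ∧ b < c ∧ c < d ∧ d < π.1) ∧
      val π c < val π a ∧ val π a < val π d ∧ val π d < val π b := by
  rw [perm2413, contained_ofList_iff]
  constructor
  · rintro ⟨f, hf, hv⟩
    simp only [List.length_cons, List.length_nil, Nat.forall_lt_succ_right] at hf hv
    simp at hf hv
    exact ⟨f 0, f 1, f 2, f 3, by omega, by omega⟩
  · rintro ⟨a, b, c, d, hm, hv⟩
    refine ⟨fun p => [a, b, c, d].getD p 0, ?_⟩
    simp only [List.length_cons, List.length_nil, Nat.forall_lt_succ_right]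
    simp
    omega

theorem indec_perm2413 : Indec perm2413 := indec_ofList (by decide) (by decide)

/-- The permutation `3142`. -/
noncomputable def perm3142 : FinPerm := ofList [2, 0, 3, 1] (by decide) (by decide)

theorem contained_perm3142_iff {π : FinPerm} : Contained perm3142 π ↔
    ∃ a b c d, (a < b ∧ b < c ∧ c < d ∧ d < π.1) ∧
      val π b < val π d ∧ val π d < val π a ∧ val π a < val π c := by
  rw [perm3142, contained_ofList_iff]
  constructor
  · rintro ⟨f, hf, hv⟩
    simp only [List.length_cons, List.length_nil, Nat.forall_lt_succ_right] at hf hv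
    simp at hf hv
    exact ⟨f 0, f 1, f 2, f 3, by omega, by omega⟩
  · rintro ⟨a, b, c, d, hm, hv⟩
    refine ⟨fun p => [a, b, c, d].getD p 0, ?_⟩
    simp only [List.length_cons, List.length_nil, Nat.forall_lt_succ_right]
    simp
    omega

theorem indec_perm3142 : Indec perm3142 := indec_ofList (by decide) (by decide)

/-- The permutation `456123`. -/
noncomputable def perm456123 : FinPerm := ofList [3, 4, 5, 0, 1, 2] (by decide) (by decide)

theorem contained_perm456123_iff {π : FinPerm} : Contained perm456123 π ↔
    ∃ a b c d e f, (a < b ∧ b < c ∧ c < d ∧ d < e ∧ e < f ∧ f < π.1) ∧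
      val π d < val π e ∧ val π e < val π f ∧ val π f < val π a ∧ val π a < val π b ∧
        val π b < val π c := by
  rw [perm456123, contained_ofList_iff]
  constructor
  · rintro ⟨f, hf, hv⟩
    simp only [List.length_cons, List.length_nil, Nat.forall_lt_succ_right] at hf hv
    simp at hf hv
    exact ⟨f 0, f 1, f 2, f 3, f 4, f 5, by omega, by omega⟩
  · rintro ⟨a, b, c, d, e, f, hm, hv⟩
    refine ⟨fun p => [a, b, c, d, e, f].getD p 0, ?_⟩
    simp only [List.length_cons, List.length_nil, Nat.forall_lt_succ_right]
    simp
    omega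

theorem indec_perm456123 : Indec perm456123 := indec_ofList (by decide) (by decide)

/-! ### Positions of values, and closed prefixes -/

/-- The position of the value `y` in `π`. -/
def pos (π : FinPerm) (y : ℕ) : ℕ := val ⟨π.1, π.2.symm⟩ y

theorem pos_lt {π : FinPerm} {y : ℕ} (h : y < π.1) : pos π y < π.1 :=
  val_lt (π := ⟨π.1, π.2.symm⟩) h

theorem val_pos {π : FinPerm} {y : ℕ} (h : y < π.1) : val π (pos π y) = y := by
  rw [val_of_lt (pos_lt h)]
  simp [pos, val, h]

theorem pos_val {π : FinPerm} {p : ℕ} (h : p < π.1) : pos π (val π p) = p :=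
  val_inj (pos_lt (val_lt h)) h (val_pos (val_lt h))

theorem Indec.length_eq {π : FinPerm} (h : Indec π) {k : ℕ} (hk : 0 < k) (hkn : k ≤ π.1)
    (hv : ∀ p < k, val π p < k) : π.1 = k := by
  by_contra hne
  obtain ⟨p, hp, hpv⟩ := h.2 k hk (by omega)
  have := hv p hp
  omega

/-! ### Two families of indecomposable permutations -/

/-- The values of the permutation `fork a b m`. -/
def forkVal (a b m p : ℕ) : ℕ :=
  if p < a then p + 1 else if p = a then a + 2 else if p = a + 1 then 0
  else if p = a + b + 2 * m + 2 then a + 2 * m + 1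
  else if a + 2 * m + 2 ≤ p then p + 1
  else if p % 2 = a % 2 then p + 2 else p - 2

/-- The nested conditionals in the flat form that `omega` can use; nearly every computation with
`fork` goes through it. -/
theorem forkVal_spec (a b m p : ℕ) :
    (p < a ∧ forkVal a b m p = p + 1) ∨ (p = a ∧ forkVal a b m p = a + 2) ∨
    (p = a + 1 ∧ forkVal a b m p = 0) ∨
    (p = a + b + 2 * m + 2 ∧ forkVal a b m p = a + 2 * m + 1) ∨
    (a + 2 * m + 2 ≤ p ∧ p ≠ a + b + 2 * m + 2 ∧ forkVal a b m p = p + 1) ∨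
    (a + 1 < p ∧ p < a + 2 * m + 2 ∧ p % 2 = a % 2 ∧ forkVal a b m p = p + 2) ∨
    (a + 1 < p ∧ p < a + 2 * m + 2 ∧ p % 2 ≠ a % 2 ∧ forkVal a b m p = p - 2) := by
  unfold forkVal
  split_ifs <;> omega

theorem forkVal_last (a b m : ℕ) : forkVal a b m (a + b + 2 * m + 2) = a + 2 * m + 1 := by
  have := forkVal_spec a b m (a + b + 2 * m + 2)
  omega

theorem forkVal_run {a b m p : ℕ} (h : a + 2 * m + 2 ≤ p) (h' : p < a + b + 2 * m + 2) :
    forkVal a b m p = p + 1 := by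
  have := forkVal_spec a b m p
  omega

theorem forkVal_up (a b m : ℕ) : forkVal a b (m + 1) (a + 2) = a + 4 := by
  have := forkVal_spec a b (m + 1) (a + 2)
  omega

theorem forkVal_down (a b m : ℕ) : forkVal a b (m + 1) (a + 3) = a + 1 := by
  have := forkVal_spec a b (m + 1) (a + 3)
  omega

/-- One turn of the oscillation traded for two steps of the initial run changes nothing further
right; this is the induction step of `OneHole.tail`. -/
theorem forkVal_succ {a b m p : ℕ} (h : a + 4 ≤ p) :
    forkVal (a + 2) b m p = forkVal a b (m + 1) p := by
  have h1 := forkVal_spec (a + 2) b m p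
  have h2 := forkVal_spec a b (m + 1) p
  omega

/-- An increasing oscillation whose two ends are thickened by increasing runs: `a + 1` entries lie
above and before the least entry, and `b` consecutive greatest entries precede the last one. -/
noncomputable def fork (a b m : ℕ) : FinPerm :=
  ofFun (a + b + 2 * m + 3) (forkVal a b m)
    (fun p hp => by have := forkVal_spec a b m p; omega)
    (fun p q hpq hq => by
      have := forkVal_spec a b m p
      have := forkVal_spec a b m q
      omega)

@[simp] theorem fork_fst (a b m : ℕ) : (fork a b m).1 = a + b + 2 * m + 3 := rfl

theorem val_fork {a b m p : ℕ} (h : p < a + b + 2 * m + 3) :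
    val (fork a b m) p = forkVal a b m p := val_ofFun h

theorem muFun_val (j p : ℕ) (hp : p < 2 * j + 7) : (muFun j ⟨p, hp⟩).1 =
    if p ≤ 1 then p + 1 else if p = 3 then 0 else if p = 2 * j + 6 then p - 3
    else if 2 * j + 4 ≤ p then p + 1 else if p % 2 = 0 then p + 2 else p - 2 := by
  unfold muFun
  split_ifs <;> rfl

theorem mu_eq_fork (j : ℕ) : mu j = fork 2 2 j := by
  refine ext_val (show 2 * j + 7 = 2 + 2 + 2 * j + 3 by omega) fun p hp => ?_
  have hp' : p < 2 * j + 7 := hp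
  rw [val_fork (by omega), val_of_lt hp]
  change (muFun j ⟨p, hp'⟩).1 = _
  have := forkVal_spec 2 2 j p
  rw [muFun_val]
  split_ifs <;> omega

theorem indec_fork (a b m : ℕ) : Indec (fork a b m) := by
  refine ⟨by simp, fun k hk hkn => ?_⟩
  simp only [fork_fst] at hkn
  have h1 := val_fork (a := a) (b := b) (m := m) (p := k - 1) (by omega)
  have h2 := val_fork (a := a) (b := b) (m := m) (p := k - 2) (by omega)
  -- Every cut is crossed by one of the two entries just before it.
  by_cases h : k ≤ val (fork a b m) (k - 1)
  · exact ⟨k - 1, by omega, h⟩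
  · have h3 := forkVal_spec a b m (k - 1)
    have h4 := forkVal_spec a b m (k - 2)
    exact ⟨k - 2, by omega, by omega⟩

/-- The increasing permutation of length `k` placed above and before the one of length `m`. -/
noncomputable def skewInc (k m : ℕ) : FinPerm :=
  ofFun (k + m) (fun p => if p < k then p + m else p - k)
    (fun p hp => by split_ifs <;> omega)
    (fun p q hpq hq => by split_ifs <;> omega)

@[simp] theorem skewInc_fst (k m : ℕ) : (skewInc k m).1 = k + m := rfl

theorem val_skewInc {k m p : ℕ} (h : p < k + m) :
    val (skewInc k m) p = if p < k then p + m else p - k := val_ofFun h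

theorem indec_skewInc {k m : ℕ} (hm : 0 < m) (hk : 0 < k ∨ m = 1) : Indec (skewInc k m) := by
  refine ⟨by simp; omega, fun j hj hjn => ?_⟩
  simp only [skewInc_fst] at hjn
  by_cases hjk : j ≤ k
  · refine ⟨j - 1, by omega, ?_⟩
    rw [val_skewInc (by omega), if_pos (by omega)]
    omega
  · refine ⟨k - 1, by omega, ?_⟩
    rw [val_skewInc (by omega)]
    split_ifs <;> omega

/-! ### Reading an indecomposable permutation from left to right -/

section Reading

variable {π : FinPerm}

/-- Values skipped by the entry at `p` (holes) must be filled in increasing order, or 321 appears.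
-/
theorem pos_lt_pos_of_lt (h321 : ¬ Contained perm321 π) {p y z : ℕ} (hp : p < π.1) (hyz : y < z)
    (hz : z < val π p) (hz' : p < pos π z) : pos π y < pos π z := by
  have h0 := val_lt hp
  by_contra hc
  have hne : pos π y ≠ pos π z := fun h => by
    have h1 := val_pos (π := π) (y := y) (by omega)
    have h2 := val_pos (π := π) (y := z) (by omega)
    rw [h] at h1
    omega
  refine h321 (contained_perm321_iff.mpr
    ⟨p, pos π z, pos π y, ⟨hz', by omega, pos_lt (by omega)⟩, ?_⟩)
  rw [val_pos (by omega), val_pos (by omega)]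
  omega

theorem not_three_holes (h321 : ¬ Contained perm321 π) (h4123 : ¬ Contained perm4123 π)
    {p x y z : ℕ} (hp : p < π.1) (hxy : x < y) (hyz : y < z) (hz : z < val π p)
    (hx' : p < pos π x) (hy' : p < pos π y) (hz' : p < pos π z) : False := by
  have h0 := val_lt hp
  have h1 := pos_lt_pos_of_lt h321 hp hxy (by omega) hy'
  have h2 := pos_lt_pos_of_lt h321 hp hyz (by omega) hz'
  refine h4123 (contained_perm4123_iff.mpr
    ⟨p, pos π x, pos π y, pos π z, ⟨hx', h1, h2, pos_lt (by omega)⟩, ?_⟩)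
  rw [val_pos (by omega), val_pos (by omega), val_pos (by omega)]
  omega

/-- With two holes open, a larger next entry would complete 3412 with them, and the larger hole
cannot be filled before the smaller. -/
theorem val_succ_of_two_holes (h321 : ¬ Contained perm321 π) (h3412 : ¬ Contained perm3412 π)
    {p x y : ℕ} (hp : p + 1 < π.1) (hxy : x < y) (hy : y < val π p)
    (hx' : p < pos π x) (hy' : p < pos π y) : val π (p + 1) < val π p ∧ val π (p + 1) ≠ y := by
  have h0 := val_lt (π := π) (p := p) (by omega)
  have h1 := pos_lt_pos_of_lt h321 (p := p) (by omega) hxy (by omega) hy'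
  have hpy := val_pos (π := π) (y := y) (by omega)
  have hpx := val_pos (π := π) (y := x) (by omega)
  have hy0 : val π (p + 1) ≠ y := fun h => by
    have := pos_val hp
    rw [h] at this
    omega
  have hx0 : pos π x ≠ p + 1 ∨ val π (p + 1) = x := by
    by_cases h : pos π x = p + 1
    · rw [h] at hpx
      exact Or.inr hpx
    · exact Or.inl h
  refine ⟨?_, hy0⟩
  by_contra hc
  have hne : val π p ≠ val π (p + 1) := fun h => by
    have := val_inj (by omega) hp h
    omega
  refine h3412 (contained_perm3412_iff.mpr
    ⟨p, p + 1, pos π x, pos π y, ⟨by omega, by omega, h1, pos_lt (by omega)⟩, ?_⟩)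
  rw [hpx, hpy]
  omega

/-- The first `k + 2` entries of `π` are the values up to `k + 2` except `k + 1`, and end with
`k + 2` and a smaller value. -/
structure OneHole (π : FinPerm) (k : ℕ) : Prop where
  lt_length : k + 2 < π.1
  val_last : val π k = k + 2
  val_low : val π (k + 1) < k + 1
  pos_low : ∀ y ≤ k + 2, y ≠ k + 1 → pos π y < k + 2
  pos_hole : k + 2 ≤ pos π (k + 1)
  pos_high : ∀ y, k + 2 < y → y < π.1 → k + 2 ≤ pos π y

/-- With the single hole `k + 1` open, the next entry fills it (and indecomposability ends `π`),
equals `k + 3` (the final run begins), or equals `k + 4` (one more turn, leading to `OneHole` at `k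
+ 2`). Anything larger opens three holes. `N` only bounds the remaining length for the induction. -/
theorem OneHole.tail (hπ : Indec π) (h321 : ¬ Contained perm321 π)
    (h4123 : ¬ Contained perm4123 π) (h3412 : ¬ Contained perm3412 π)
    (h314625 : ¬ Contained perm314625 π) (h23451 : ¬ Contained perm23451 π) (N : ℕ) :
    ∀ k, π.1 - k ≤ N → OneHole π k → ∃ m b, b ≤ 2 ∧ π.1 = k + b + 2 * m + 3 ∧
      ∀ p, k + 2 ≤ p → p < π.1 → val π p = forkVal k b m p := by
  induction N with
  | zero =>
    intro k hk h
    have := h.lt_length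
    omega
  | succ N ih =>
    intro k hk h
    obtain ⟨hn, h0, h1, hlow, hhole, hhigh⟩ := h
    have hw0 := val_pos (π := π) (y := k + 1) (by omega)
    have hwn := pos_lt (π := π) (y := k + 1) (by omega)
    have hval : ∀ p, k + 2 ≤ p → p < π.1 → val π p = k + 1 ∨ k + 2 < val π p := by
      intro p hp hpn
      have := hlow (val π p)
      rw [pos_val hpn] at this
      omega
    have hpre : ∀ p, p < k + 2 → val π p ≤ k + 2 := by
      intro p hp
      have := hhigh (val π p)
      rw [pos_val (by omega)] at this
      have := val_lt (π := π) (p := p) (by omega)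
      omega
    have hne : ∀ p q, p < q → q < π.1 → val π p ≠ val π q := fun p q hpq hq he => by
      have := val_inj (hpq.trans hq) hq he
      omega
    have hclosed : ∀ q, k + 2 ≤ q → q < π.1 → val π q = k + 1 →
        (∀ p, k + 2 ≤ p → p < q → val π p ≤ q) → π.1 = q + 1 := by
      intro q hq hqn hv hle
      refine hπ.length_eq (by omega) (by omega) fun p hp => ?_
      rcases lt_trichotomy p q with h | rfl | h
      · by_cases hpk : p < k + 2
        · have := hpre p hpk
          omega
        · have := hle p (by omega) h
          omega
      · omega
      · omega
    have hv2 := val_lt hn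
    rcases hval (k + 2) le_rfl hn with e2 | e2
    · have := hclosed (k + 2) le_rfl hn e2 (by omega)
      refine ⟨0, 0, by omega, by omega, fun p hp hpn => ?_⟩
      obtain rfl : p = k + 2 := by omega
      rw [e2]
      exact (forkVal_last k 0 0).symm
    have hw2 : pos π (k + 1) ≠ k + 2 := fun h => by
      rw [h] at hw0
      omega
    obtain e2' | e2' | e2' : val π (k + 2) = k + 3 ∨ val π (k + 2) = k + 4 ∨
        k + 4 < val π (k + 2) := by omega
    · have hn3 : k + 3 < π.1 := by omega
      have hv3 := val_lt hn3
      rcases hval (k + 3) (by omega) hn3 with e3 | e3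
      · have := hclosed (k + 3) (by omega) hn3 e3 (fun p hp hpq => by
          obtain rfl : p = k + 2 := by omega
          omega)
        refine ⟨0, 1, by omega, by omega, fun p hp hpn => ?_⟩
        obtain rfl | rfl : p = k + 2 ∨ p = k + 3 := by omega
        · rw [e2', forkVal_run (by omega) (by omega)]
        · rw [e3]
          exact (forkVal_last k 1 0).symm
      have hne3 := hne (k + 2) (k + 3) (by omega) hn3
      have hw3 : pos π (k + 1) ≠ k + 3 := fun h => by
        rw [h] at hw0
        omega
      obtain e3' | e3' : val π (k + 3) = k + 4 ∨ k + 4 < val π (k + 3) := by omega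
      · have hn4 : k + 4 < π.1 := by omega
        rcases hval (k + 4) (by omega) hn4 with e4 | e4
        · have := hclosed (k + 4) (by omega) hn4 e4 (fun p hp hpq => by
            obtain rfl | rfl : p = k + 2 ∨ p = k + 3 := by omega
            all_goals omega)
          refine ⟨0, 2, by omega, by omega, fun p hp hpn => ?_⟩
          obtain rfl | rfl | rfl : p = k + 2 ∨ p = k + 3 ∨ p = k + 4 := by omega
          · rw [e2', forkVal_run (by omega) (by omega)]
          · rw [e3', forkVal_run (by omega) (by omega)]
          · rw [e4]
            exact (forkVal_last k 2 0).symm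
        · exfalso
          have hne4 := hne (k + 2) (k + 4) (by omega) hn4
          have hne4' := hne (k + 3) (k + 4) (by omega) hn4
          have hw4 : pos π (k + 1) ≠ k + 4 := fun h => by
            rw [h] at hw0
            omega
          -- A third run entry before the hole is filled: `k + 2` and the run form 2345, and the
          -- hole is the 1.
          exact h23451 (contained_perm23451_iff.mpr
            ⟨k, k + 2, k + 3, k + 4, pos π (k + 1), by omega, by omega⟩)
      · exfalso
        have hy0 := val_pos (π := π) (y := k + 4) (by omega)
        have hyn := pos_lt (π := π) (y := k + 4) (by omega)
        have hy1 := hhigh (k + 4) (by omega) (by omega)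
        have hy2 : pos π (k + 4) ≠ k + 2 := fun h => by
          rw [h] at hy0
          omega
        have hy3 : pos π (k + 4) ≠ k + 3 := fun h => by
          rw [h] at hy0
          omega
        have := pos_lt_pos_of_lt h321 hn3 (y := k + 1) (z := k + 4) (by omega) e3' (by omega)
        -- The run may not skip `k + 4`: the two holes play 2 and 5, and the four consecutive
        -- entries from `k` on play 3, 1, 4, 6.
        exact h314625 (contained_perm314625_iff.mpr
          ⟨k, k + 1, k + 2, k + 3, pos π (k + 1), pos π (k + 4), by omega, by omega⟩)
    · have hn3 : k + 3 < π.1 := by omega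
      have hy0 := val_pos (π := π) (y := k + 3) (by omega)
      have hy1 := hhigh (k + 3) (by omega) (by omega)
      have hy2 : pos π (k + 3) ≠ k + 2 := fun h => by
        rw [h] at hy0
        omega
      -- Holes `k + 1` and `k + 3` are open, so the next entry must be `k + 1`.
      have h3 := val_succ_of_two_holes h321 h3412 (p := k + 2) (x := k + 1) (y := k + 3) hn3
        (by omega) (by omega) (by omega) (by omega)
      have e3 : val π (k + 3) = k + 1 := by
        have := hval (k + 3) (by omega) hn3
        have : k + 2 + 1 = k + 3 := rfl
        rw [this] at h3
        omega
      have hy3 : pos π (k + 3) ≠ k + 3 := fun h => by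
        rw [h] at hy0
        omega
      have hp1 := pos_val hn
      have hp3 := pos_val hn3
      rw [e2'] at hp1
      rw [e3] at hp3
      obtain ⟨m, b, hb, hlen, hv⟩ := ih (k + 2) (by omega)
        ⟨by omega, by rw [e2'], by change val π (k + 3) < _; omega, fun y hy hy' => by
          rcases Nat.lt_or_ge y (k + 3) with g | g
          · by_cases hyk : y = k + 1
            · subst hyk
              omega
            · have := hlow y (by omega) hyk
              omega
          · obtain rfl : y = k + 4 := by omega
            omega, by change _ ≤ pos π (k + 3); omega, fun y hy hyn => by
          have g0 := hhigh y (by omega) hyn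
          have g1 := val_pos hyn
          have g2 : pos π y ≠ k + 2 := fun h => by
            rw [h] at g1
            omega
          have g3 : pos π y ≠ k + 3 := fun h => by
            rw [h] at g1
            omega
          omega⟩
      refine ⟨m + 1, b, hb, by omega, fun p hp hpn => ?_⟩
      rcases Nat.lt_or_ge p (k + 4) with g | g
      · obtain rfl | rfl : p = k + 2 ∨ p = k + 3 := by omega
        · rw [e2', forkVal_up]
        · rw [e3, forkVal_down]
      · rw [hv p (by omega) hpn, forkVal_succ g]
    · exfalso
      have hy0 := val_pos (π := π) (y := k + 3) (by omega)
      have hy1 := hhigh (k + 3) (by omega) (by omega)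
      have hy2 : pos π (k + 3) ≠ k + 2 := fun h => by
        rw [h] at hy0
        omega
      have hz0 := val_pos (π := π) (y := k + 4) (by omega)
      have hz1 := hhigh (k + 4) (by omega) (by omega)
      have hz2 : pos π (k + 4) ≠ k + 2 := fun h => by
        rw [h] at hz0
        omega
      exact not_three_holes h321 h4123 (p := k + 2) (x := k + 1) (y := k + 3) (z := k + 4) hn
        (by omega) (by omega) (by omega) (by omega) (by omega) (by omega)

end Reading

/-! ### The initial run and the classification -/

section Start

variable {π : FinPerm} {a : ℕ}

theorem eq_skewInc_of_start (hπ : Indec π) (ha : a < π.1) (hv : ∀ p < a, val π p = p + 1)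
    (h0 : val π a = 0) : π = skewInc a 1 := by
  have hn : π.1 = a + 1 := hπ.length_eq (by omega) (by omega) fun p hp => by
    rcases Nat.lt_succ_iff_lt_or_eq.mp hp with h | rfl
    · have := hv p h
      omega
    · omega
  refine ext_val hn fun p hp => ?_
  rw [val_skewInc (by omega)]
  split_ifs with h
  · exact hv p h
  · obtain rfl : p = a := by omega
    omega

theorem val_start (ha : a < π.1) (hv : ∀ p < a, val π p = p + 1) :
    val π a = 0 ∨ a + 1 ≤ val π a := by
  by_contra hc
  have h1 := hv (val π a - 1) (by omega)
  have := val_inj (by omega) ha (h1.trans (by omega))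
  omega

theorem le_pos_of_start (hv : ∀ p < a, val π p = p + 1) {y : ℕ} (hy : y < π.1)
    (h : y = 0 ∨ a < y) : a ≤ pos π y := by
  by_contra hc
  have h1 := hv (pos π y) (by omega)
  rw [val_pos hy] at h1
  omega

theorem lt_pos_of_start (hv : ∀ p < a, val π p = p + 1) {y : ℕ} (hy : y < π.1)
    (h : y = 0 ∨ a < y) (hya : y ≠ val π a) : a < pos π y := by
  refine lt_of_le_of_ne (le_pos_of_start hv hy h) fun he => hya ?_
  rw [he, val_pos hy]

theorem val_start_le (h321 : ¬ Contained perm321 π) (h4123 : ¬ Contained perm4123 π)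
    (ha : a < π.1) (hv : ∀ p < a, val π p = p + 1) : val π a ≤ a + 2 := by
  by_contra hc
  have := val_lt ha
  exact not_three_holes h321 h4123 ha (x := 0) (y := a + 1) (z := a + 2) (by omega) (by omega)
    (by omega) (lt_pos_of_start hv (by omega) (by omega) (by omega))
    (lt_pos_of_start hv (by omega) (by omega) (by omega))
    (lt_pos_of_start hv (by omega) (by omega) (by omega))

theorem val_succ_start (h321 : ¬ Contained perm321 π) (h3412 : ¬ Contained perm3412 π)
    (ha : a < π.1) (hv : ∀ p < a, val π p = p + 1) (h2 : val π a = a + 2) :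
    val π (a + 1) = 0 := by
  have hn := val_lt ha
  have h := val_succ_of_two_holes h321 h3412 (p := a) (x := 0) (y := a + 1) (by omega) (by omega)
    (by omega) (lt_pos_of_start hv (by omega) (by omega) (by omega))
    (lt_pos_of_start hv (by omega) (by omega) (by omega))
  by_contra hc
  have h1 := hv (val π (a + 1) - 1) (by omega)
  have := val_inj (by omega) (by omega) (h1.trans (show _ = val π (a + 1) by omega))
  omega

theorem oneHole_of_start (h321 : ¬ Contained perm321 π) (h3412 : ¬ Contained perm3412 π)
    (ha : a < π.1) (hv : ∀ p < a, val π p = p + 1) (h2 : val π a = a + 2) : OneHole π a := by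
  have hn := val_lt ha
  have h0 := val_succ_start h321 h3412 ha hv h2
  have hy : ∀ y, y < π.1 → y = 0 ∨ a < y → y ≠ a + 2 → y ≠ 0 → a + 2 ≤ pos π y := by
    intro y hy h hy2 hy0
    have h3 := lt_pos_of_start hv hy h (by omega)
    have h4 : pos π y ≠ a + 1 := fun he => by
      have := val_pos hy
      rw [he] at this
      omega
    omega
  refine ⟨by omega, h2, by omega, fun y hy hya => ?_, hy _ (by omega) (by omega) (by omega)
    (by omega), fun y h h' => hy y h' (by omega) (by omega) (by omega)⟩
  obtain rfl | rfl | h : y = 0 ∨ y = a + 2 ∨ (0 < y ∧ y ≤ a) := by omega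
  · rw [← h0, pos_val (by omega)]
    omega
  · rw [← h2, pos_val (by omega)]
    omega
  · have h3 := hv (y - 1) (by omega)
    rw [show y = val π (y - 1) by omega, pos_val (by omega)]
    omega

/-- The indecomposable permutations avoiding five patterns. -/
theorem indec_cases (hπ : Indec π) (h321 : ¬ Contained perm321 π)
    (h4123 : ¬ Contained perm4123 π) (h3412 : ¬ Contained perm3412 π)
    (h314625 : ¬ Contained perm314625 π) (h23451 : ¬ Contained perm23451 π) :
    (∃ k ≤ 3, π = skewInc k 1) ∨ ∃ a b m, a ≤ 2 ∧ b ≤ 2 ∧ π = fork a b m := by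
  -- After an initial run of length `a`, either `π` is completely determined or the run extends by
  -- one; a fourth run entry would give 23451.
  have step : ∀ a, a ≤ 2 → a < π.1 → (∀ p < a, val π p = p + 1) →
      ((∃ k ≤ 3, π = skewInc k 1) ∨ ∃ a b m, a ≤ 2 ∧ b ≤ 2 ∧ π = fork a b m) ∨
      (a + 1 < π.1 ∧ ∀ p < a + 1, val π p = p + 1) := by
    intro a ha2 ha hv
    have hn := val_lt ha
    have hle := val_start_le h321 h4123 ha hv
    obtain h | h | h : val π a = 0 ∨ val π a = a + 1 ∨ val π a = a + 2 := by
      have := val_start ha hv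
      omega
    · exact Or.inl (Or.inl ⟨a, by omega, eq_skewInc_of_start hπ ha hv h⟩)
    · refine Or.inr ⟨by omega, fun p hp => ?_⟩
      rcases Nat.lt_succ_iff_lt_or_eq.mp hp with h' | rfl
      · exact hv p h'
      · exact h
    · obtain ⟨m, b, hb, hlen, htail⟩ := (oneHole_of_start h321 h3412 ha hv h).tail hπ h321 h4123
        h3412 h314625 h23451 _ a le_rfl
      refine Or.inl (Or.inr ⟨a, b, m, ha2, hb, ext_val (by simpa using hlen) fun p hp => ?_⟩)
      rw [val_fork (by omega)]
      have hs := forkVal_spec a b m p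
      obtain h' | rfl | rfl | h' : p < a ∨ p = a ∨ p = a + 1 ∨ a + 2 ≤ p := by omega
      · rw [hv p h']
        omega
      · rw [h]
        omega
      · rw [val_succ_start h321 h3412 ha hv h]
        omega
      · exact htail p h' hp
  rcases step 0 (by omega) hπ.1 (fun p hp => by omega) with h | ⟨h1, hv1⟩
  · exact h
  rcases step 1 (by omega) h1 hv1 with h | ⟨h2, hv2⟩
  · exact h
  rcases step 2 (by omega) h2 hv2 with h | ⟨h3, hv3⟩
  · exact h
  rcases val_start h3 hv3 with h | h
  · exact Or.inl ⟨3, le_rfl, eq_skewInc_of_start hπ h3 hv3 h⟩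
  · exfalso
    have g0 := lt_pos_of_start hv3 hπ.1 (Or.inl rfl) (by omega)
    change 4 ≤ val π 3 at h
    have e0 := val_pos hπ.1
    have e1 := pos_lt hπ.1
    have w0 := hv3 0 (by omega)
    have w1 := hv3 1 (by omega)
    have w2 := hv3 2 (by omega)
    exact h23451 (contained_perm23451_iff.mpr ⟨0, 1, 2, 3, pos π 0, by omega, by omega⟩)

end Start

/-! ### The antichain -/

@[simp] theorem mu_fst (j : ℕ) : (mu j).1 = 2 * j + 7 := rfl

theorem val_mu {j p : ℕ} (h : p < 2 * j + 7) : val (mu j) p = forkVal 2 2 j p := by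
  rw [mu_eq_fork, val_fork (by omega)]

/-- Listing all inversions by their right end makes pattern avoidance linear arithmetic. Only the
two extreme right ends, 3 and `2 * j + 6`, have three partners; the others have two. -/
theorem mu_inversion {j p q : ℕ} (hpq : p < q) (hq : q < 2 * j + 7)
    (h : val (mu j) q < val (mu j) p) :
    (q = 3 ∧ p ≤ 2) ∨ (q % 2 = 1 ∧ 5 ≤ q ∧ q ≤ 2 * j + 3 ∧ (p + 3 = q ∨ p + 1 = q)) ∨
      (q = 2 * j + 6 ∧ (p = 2 * j + 2 ∨ p = 2 * j + 4 ∨ p = 2 * j + 5)) := by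
  rw [val_mu (by omega), val_mu (by omega)] at h
  have h1 := forkVal_spec 2 2 j p
  have h2 := forkVal_spec 2 2 j q
  omega

theorem mu_avoids_321 (j : ℕ) : ¬ Contained perm321 (mu j) := by
  rw [contained_perm321_iff]
  rintro ⟨a, b, c, h, hv⟩
  rw [mu_fst] at h
  have h1 := mu_inversion (j := j) (p := a) (q := b) (by omega) (by omega) (by omega)
  have h2 := mu_inversion (j := j) (p := b) (q := c) (by omega) (by omega) (by omega)
  omega

theorem mu_avoids_4123 (j : ℕ) : ¬ Contained perm4123 (mu j) := by
  rw [contained_perm4123_iff]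
  rintro ⟨a, b, c, d, h, hv⟩
  rw [mu_fst] at h
  have h1 := mu_inversion (j := j) (p := a) (q := b) (by omega) (by omega) (by omega)
  have h2 := mu_inversion (j := j) (p := a) (q := c) (by omega) (by omega) (by omega)
  have h3 := mu_inversion (j := j) (p := a) (q := d) (by omega) (by omega) (by omega)
  omega

theorem mu_avoids_3412 (j : ℕ) : ¬ Contained perm3412 (mu j) := by
  rw [contained_perm3412_iff]
  rintro ⟨a, b, c, d, h, hv⟩
  rw [mu_fst] at h
  have h1 := mu_inversion (j := j) (p := a) (q := c) (by omega) (by omega) (by omega)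
  have h2 := mu_inversion (j := j) (p := a) (q := d) (by omega) (by omega) (by omega)
  have h3 := mu_inversion (j := j) (p := b) (q := c) (by omega) (by omega) (by omega)
  have h4 := mu_inversion (j := j) (p := b) (q := d) (by omega) (by omega) (by omega)
  omega

theorem mu_avoids_314625 (j : ℕ) : ¬ Contained perm314625 (mu j) := by
  rw [contained_perm314625_iff]
  rintro ⟨a, b, c, d, e, f, h, hv⟩
  rw [mu_fst] at h
  have h1 := mu_inversion (j := j) (p := a) (q := e) (by omega) (by omega) (by omega)
  have h2 := mu_inversion (j := j) (p := c) (q := e) (by omega) (by omega) (by omega)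
  have h3 := mu_inversion (j := j) (p := d) (q := e) (by omega) (by omega) (by omega)
  omega

theorem mu_avoids_23451 (j : ℕ) : ¬ Contained perm23451 (mu j) := by
  rw [contained_perm23451_iff]
  rintro ⟨a, b, c, d, e, h, hv⟩
  rw [mu_fst] at h
  have h1 := mu_inversion (j := j) (p := a) (q := e) (by omega) (by omega) (by omega)
  have h2 := mu_inversion (j := j) (p := b) (q := e) (by omega) (by omega) (by omega)
  have h3 := mu_inversion (j := j) (p := c) (q := e) (by omega) (by omega) (by omega)
  have h4 := mu_inversion (j := j) (p := d) (q := e) (by omega) (by omega) (by omega)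
  omega

/-- A right end with three partners must go to such an end, so the left ends of the two oscillations
match. Following inversions along the oscillation leaves no freedom, and the thick right end of `mu
j` can only meet that of `mu k`. -/
theorem mu_antichain {j k : ℕ} (h : Contained (mu j) (mu k)) : j = k := by
  obtain ⟨f, hf, hm, hv⟩ := h.exists_fun
  simp only [mu_fst] at hf hm hv
  have inv : ∀ p q, p < q → q < 2 * j + 7 → forkVal 2 2 j q < forkVal 2 2 j p →
      (f q = 3 ∧ f p ≤ 2) ∨
      (f q % 2 = 1 ∧ 5 ≤ f q ∧ f q ≤ 2 * k + 3 ∧ (f p + 3 = f q ∨ f p + 1 = f q)) ∨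
      (f q = 2 * k + 6 ∧ (f p = 2 * k + 2 ∨ f p = 2 * k + 4 ∨ f p = 2 * k + 5)) := by
    intro p q hpq hq hlt
    rw [← val_mu (by omega), ← val_mu (by omega), hv q p (by omega) (by omega)] at hlt
    exact mu_inversion (hm p q hpq hq) (hf q hq) hlt
  have hlast := hf (2 * j + 6) (by omega)
  have h3 : f 2 = 2 ∧ f 3 = 3 := by
    have e0 := forkVal_spec 2 2 j 0
    have e1 := forkVal_spec 2 2 j 1
    have e2 := forkVal_spec 2 2 j 2
    have e3 := forkVal_spec 2 2 j 3
    have i0 := inv 0 3 (by omega) (by omega) (by omega)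
    have i1 := inv 1 3 (by omega) (by omega) (by omega)
    have i2 := inv 2 3 (by omega) (by omega) (by omega)
    have m0 := hm 0 1 (by omega) (by omega)
    have m1 := hm 1 2 (by omega) (by omega)
    have m3 := hm 3 (2 * j + 6) (by omega) (by omega)
    omega
  -- Positions `2 * r + 2` and `2 * r + 5` are inverted, which fixes the image of the latter; that
  -- of `2 * r + 4` is then squeezed in.
  have hr : ∀ r, r ≤ j → f (2 * r + 2) = 2 * r + 2 ∧ f (2 * r + 3) = 2 * r + 3 := by
    intro r
    induction r with
    | zero => exact fun _ => h3
    | succ r ih =>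
      intro hrj
      obtain ⟨h1, h2⟩ := ih (by omega)
      have e2 := forkVal_spec 2 2 j (2 * r + 2)
      have e5 := forkVal_spec 2 2 j (2 * r + 5)
      have i2 := inv (2 * r + 2) (2 * r + 5) (by omega) (by omega) (by omega)
      have m3 := hm (2 * r + 3) (2 * r + 4) (by omega) (by omega)
      have m4 := hm (2 * r + 4) (2 * r + 5) (by omega) (by omega)
      have m5 := hm (2 * r + 5) (2 * j + 6) (by omega) (by omega)
      rw [show 2 * (r + 1) + 2 = 2 * r + 4 by ring, show 2 * (r + 1) + 3 = 2 * r + 5 by ring]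
      omega
  obtain ⟨h1, -⟩ := hr j le_rfl
  have e2 := forkVal_spec 2 2 j (2 * j + 2)
  have e4 := forkVal_spec 2 2 j (2 * j + 4)
  have e5 := forkVal_spec 2 2 j (2 * j + 5)
  have e6 := forkVal_spec 2 2 j (2 * j + 6)
  have i2 := inv (2 * j + 2) (2 * j + 6) (by omega) (by omega) (by omega)
  have i4 := inv (2 * j + 4) (2 * j + 6) (by omega) (by omega) (by omega)
  have i5 := inv (2 * j + 5) (2 * j + 6) (by omega) (by omega) (by omega)
  have m2 := hm (2 * j + 2) (2 * j + 4) (by omega) (by omega)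
  have m4 := hm (2 * j + 4) (2 * j + 5) (by omega) (by omega)
  omega

/-- Delete the first `2 - a` entries of `mu m` and the `2 - b` entries just before its last. -/
theorem contained_fork_mu {a b : ℕ} (ha : a ≤ 2) (hb : b ≤ 2) (m : ℕ) :
    Contained (fork a b m) (mu m) := by
  have key : ∀ p, p < a + b + 2 * m + 3 →
      forkVal 2 2 m (if p < a + b + 2 * m + 2 then p + (2 - a) else 2 * m + 6) =
        if forkVal a b m p = 0 then 0 else forkVal a b m p + (2 - a) := by
    intro p hp
    have h1 := forkVal_spec a b m p
    split_ifs
    · have h2 := forkVal_spec 2 2 m (p + (2 - a))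
      omega
    · have h2 := forkVal_spec 2 2 m (p + (2 - a))
      omega
    · have h2 := forkVal_spec 2 2 m (2 * m + 6)
      omega
    · have h2 := forkVal_spec 2 2 m (2 * m + 6)
      omega
  refine contained_of (fun p => if p < a + b + 2 * m + 2 then p + (2 - a) else 2 * m + 6) ?_ ?_ ?_
  · intro p hp
    simp only [fork_fst, mu_fst] at hp ⊢
    split_ifs <;> omega
  · intro p q hpq hq
    simp only [fork_fst] at hq
    split_ifs <;> omega
  · intro p q hpq hq
    simp only [fork_fst] at hq
    have h1 := key p (by omega)
    have h2 := key q (by omega)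
    rw [val_fork (by omega), val_fork (by omega), val_mu (by split_ifs <;> omega),
      val_mu (by split_ifs <;> omega), h1, h2]
    split_ifs <;> omega

theorem contained_skewInc_mu {k : ℕ} (hk : k ≤ 3) (m : ℕ) : Contained (skewInc k 1) (mu m) := by
  refine contained_of (fun p => if p < k then p else 3) ?_ ?_ ?_
  · intro p hp
    simp only [mu_fst]
    split_ifs <;> omega
  · intro p q hpq hq
    simp only [skewInc_fst] at hq
    split_ifs <;> omega
  · intro p q hpq hq
    simp only [skewInc_fst] at hq
    rw [val_skewInc (by omega), val_skewInc (by omega), val_mu (by split_ifs <;> omega),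
      val_mu (by split_ifs <;> omega)]
    have h1 := forkVal_spec 2 2 m p
    have h2 := forkVal_spec 2 2 m q
    have h3 := forkVal_spec 2 2 m 3
    split_ifs <;> omega

/-! ### The truncated classes -/

/-- Permutations whose avoidance defines `truncatedClass i`. -/
def truncatedBasis (i : ℕ) : Set FinPerm :=
  {perm321, perm4123, perm3412, perm314625, perm23451} ∪ mu '' Set.Iic i

theorem truncatedBasis_finite (i : ℕ) : (truncatedBasis i).Finite :=
  (Set.toFinite _).union ((Set.finite_Iic i).image mu)

theorem indec_truncatedBasis (i : ℕ) : ∀ β ∈ truncatedBasis i, Indec β := by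
  rintro β ((rfl | rfl | rfl | rfl | rfl) | ⟨j, -, rfl⟩)
  · exact indec_perm321
  · exact indec_perm4123
  · exact indec_perm3412
  · exact indec_perm314625
  · exact indec_perm23451
  · rw [mu_eq_fork]
    exact indec_fork 2 2 j

/-- If `mu j ≤ π ≤ mu k`, the antichain property gives `j = k` and hence `π = mu j`. -/
theorem mem_av_truncatedBasis_of_contained {i k : ℕ} {π : FinPerm} (h : Contained π (mu k))
    (hne : ∀ j ≤ i, π ≠ mu j) : π ∈ Av (truncatedBasis i) := by
  rintro β ((rfl | rfl | rfl | rfl | rfl) | ⟨j, hj, rfl⟩) hc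
  · exact mu_avoids_321 k (hc.trans h)
  · exact mu_avoids_4123 k (hc.trans h)
  · exact mu_avoids_3412 k (hc.trans h)
  · exact mu_avoids_314625 k (hc.trans h)
  · exact mu_avoids_23451 k (hc.trans h)
  · obtain rfl := mu_antichain (hc.trans h)
    exact hne j hj (h.eq_of_length_le hc.length_le)

theorem indec_mem_av_truncatedBasis_iff {i : ℕ} {π : FinPerm} :
    Indec π ∧ π ∈ Av (truncatedBasis i) ↔ (∃ k ≤ 3, π = skewInc k 1) ∨
      ∃ a b m, a ≤ 2 ∧ b ≤ 2 ∧ ¬ (a = 2 ∧ b = 2 ∧ m ≤ i) ∧ π = fork a b m := by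
  constructor
  · rintro ⟨hπ, h⟩
    have hB : ∀ β ∈ ({perm321, perm4123, perm3412, perm314625, perm23451} : Set FinPerm),
        ¬ Contained β π := fun β hβ => h β (Or.inl hβ)
    rcases indec_cases hπ (hB _ (by simp)) (hB _ (by simp)) (hB _ (by simp)) (hB _ (by simp))
      (hB _ (by simp)) with h' | ⟨a, b, m, ha, hb, rfl⟩
    · exact Or.inl h'
    · refine Or.inr ⟨a, b, m, ha, hb, ?_, rfl⟩
      rintro ⟨rfl, rfl, hm⟩
      refine h (mu m) (Or.inr ⟨m, hm, rfl⟩) ?_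
      rw [mu_eq_fork]
      exact Contained.refl _
  · rintro (⟨k, hk, rfl⟩ | ⟨a, b, m, ha, hb, hne, rfl⟩)
    · refine ⟨indec_skewInc (by omega) (Or.inr rfl),
        mem_av_truncatedBasis_of_contained (contained_skewInc_mu hk 0) fun j _ he => ?_⟩
      have := congrArg Sigma.fst he
      simp only [skewInc_fst, mu_fst] at this
      omega
    · refine ⟨indec_fork a b m,
        mem_av_truncatedBasis_of_contained (contained_fork_mu ha hb m) fun j hj he => hne ?_⟩
      have h1 := contained_fork_mu ha hb m
      rw [he] at h1
      obtain rfl := mu_antichain h1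
      have := congrArg Sigma.fst he
      simp only [fork_fst, mu_fst] at this
      omega

theorem truncatedClass_eq_av (i : ℕ) : truncatedClass i = Av (truncatedBasis i) := by
  apply Set.Subset.antisymm
  · intro π hπ
    refine hπ _ (isPermClass_av _) (fun σ hσ τ hτ =>
      (directSum_mem_av_iff (indec_truncatedBasis i) σ τ).mpr ⟨hσ, hτ⟩) ?_
    rintro σ ⟨⟨_, ⟨k, rfl⟩, hσ⟩, hne⟩
    exact mem_av_truncatedBasis_of_contained hσ fun j hj he => hne ⟨j, hj, he⟩
  · have hmem : ∀ σ, Indec σ → σ ∈ Av (truncatedBasis i) →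
        σ ∈ Sub Uo \ {π | ∃ j ≤ i, π = mu j} := by
      intro σ hσ h
      refine ⟨?_, ?_⟩
      · rcases indec_mem_av_truncatedBasis_iff.mp ⟨hσ, h⟩ with
          ⟨k, hk, rfl⟩ | ⟨a, b, m, ha, hb, -, rfl⟩
        · exact ⟨mu 0, ⟨0, rfl⟩, contained_skewInc_mu hk 0⟩
        · exact ⟨mu m, ⟨m, rfl⟩, contained_fork_mu ha hb m⟩
      · rintro ⟨j, hj, rfl⟩
        exact h (mu j) (Or.inr ⟨j, hj, rfl⟩) (Contained.refl _)
    have key : ∀ n, ∀ π : FinPerm, π.1 = n → π ∈ Av (truncatedBasis i) →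
        π ∈ truncatedClass i := by
      intro n
      induction n using Nat.strong_induction_on with
      | _ n ih =>
        intro π hn hπ D hD hsum hsub
        rcases Nat.eq_zero_or_pos π.1 with h0 | hpos
        -- The empty permutation is no sum of indecomposables; it enters `D` as a subpermutation of
        -- the one-point permutation.
        · have h1 : skewInc 0 1 ∈ D := by
            have := indec_mem_av_truncatedBasis_iff (i := i).mpr (Or.inl ⟨0, by omega, rfl⟩)
            exact hsub (hmem _ this.1 this.2)
          exact hD _ _ (contained_of id (fun p hp => by omega) (fun p q _ hq => by omega)
            (fun p q _ hq => by omega)) h1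
        · obtain ⟨σ, τ, hσ, rfl⟩ := exists_directSum hpos
          obtain ⟨h1, h2⟩ := (directSum_mem_av_iff (indec_truncatedBasis i) σ τ).mp hπ
          refine hsum _ (hsub (hmem σ hσ h1)) _ (ih τ.1 ?_ τ rfl h2 D hD hsum hsub)
          have := hσ.1
          simp only [directSum_fst] at hn
          omega
    exact fun π hπ => key _ π rfl hπ

/-! ### Counting the indecomposables of the truncated classes -/

theorem ncard_eq_of_image {ι : Type*} {S : Set FinPerm} (A : Finset ι) (F : ι → FinPerm)
    (hF : ∀ x ∈ A, ∀ y ∈ A, F x = F y → x = y) (hS : ∀ π, π ∈ S ↔ ∃ x ∈ A, F x = π) :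
    S.ncard = A.card := by
  have : S = F '' A := by
    ext π
    rw [hS]
    rfl
  rw [this, Set.InjOn.ncard_image (fun x hx y hy => hF x hx y hy), Set.ncard_coe_finset]

/-- The number of indecomposable members of length `n` of `truncatedClass i`. -/
def truncatedSeq (i n : ℕ) : ℕ :=
  if n ≤ 1 then n else if n = 2 then 1 else if n = 3 then 2 else if n = 4 then 3
  else if n % 2 = 1 ∧ 2 * i + 9 ≤ n then 5 else 4

/-- The types `(a, b)` for which there is a permutation `fork a b m` of length `n` in
`truncatedClass i`. -/
def forkTypes (i n : ℕ) : Finset (ℕ × ℕ) :=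
  (Finset.range 3 ×ˢ Finset.range 3).filter fun x =>
    x.1 + x.2 + 3 ≤ n ∧ (n + x.1 + x.2) % 2 = 1 ∧ ¬ (x.1 = 2 ∧ x.2 = 2 ∧ n ≤ 2 * i + 7)

theorem card_forkTypes (i : ℕ) {n : ℕ} (hn : 0 < n) :
    (forkTypes i n).card + (if n ≤ 4 then 1 else 0) = truncatedSeq i n := by
  rw [forkTypes, Finset.card_filter, Finset.sum_product]
  simp only [Finset.sum_range_succ, Finset.sum_range_zero, truncatedSeq]
  rcases Nat.mod_two_eq_zero_or_one n with h | h <;>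
    simp [Nat.add_mod, h] <;> split_ifs <;> omega

/-- The first two values determine `a ≤ 2`, the last value then `m`, and the length `b`. -/
theorem fork_inj {a b m a' b' m' : ℕ} (h : fork a b m = fork a' b' m') (ha : a ≤ 2) (ha' : a' ≤ 2) :
    a = a' ∧ b = b' ∧ m = m' := by
  have hl := congrArg Sigma.fst h
  simp only [fork_fst] at hl
  have hv : ∀ p, p < a + b + 2 * m + 3 → forkVal a b m p = forkVal a' b' m' p := by
    intro p hp
    rw [← val_fork hp, h, val_fork (by omega)]
  have h0 := hv 0 (by omega)
  have h1 := hv 1 (by omega)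
  have h2 := hv (a + b + 2 * m + 2) (by omega)
  have e0 := forkVal_spec a b m 0
  have e1 := forkVal_spec a b m 1
  have e2 := forkVal_last a b m
  have e0' := forkVal_spec a' b' m' 0
  have e1' := forkVal_spec a' b' m' 1
  have e2' := forkVal_last a' b' m'
  rw [show a' + b' + 2 * m' + 2 = a + b + 2 * m + 2 by omega] at e2'
  omega

theorem fork_ne_skewInc {a b m k : ℕ} (ha : a ≤ 2) : fork a b m ≠ skewInc k 1 := by
  intro h
  have hl := congrArg Sigma.fst h
  simp only [fork_fst, skewInc_fst] at hl
  have e1 := forkVal_spec a b m a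
  have h1 := val_fork (a := a) (b := b) (m := m) (p := a) (by omega)
  rw [h, val_skewInc (by omega)] at h1
  split_ifs at h1 <;> omega

theorem indecCount_truncated (i : ℕ) {n : ℕ} (hn : 0 < n) :
    indecCount (Av (truncatedBasis i)) n = truncatedSeq i n := by
  have hmem : ∀ x : ℕ × ℕ, x ∈ forkTypes i n ↔ (x.1 < 3 ∧ x.2 < 3) ∧ x.1 + x.2 + 3 ≤ n ∧
      (n + x.1 + x.2) % 2 = 1 ∧ ¬ (x.1 = 2 ∧ x.2 = 2 ∧ n ≤ 2 * i + 7) := by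
    intro x
    simp only [forkTypes, Finset.mem_filter, Finset.mem_product, Finset.mem_range]
  have hshort : ((Finset.range 4).filter fun k => k + 1 = n).card = if n ≤ 4 then 1 else 0 := by
    rw [Finset.card_filter]
    simp only [Finset.sum_range_succ, Finset.sum_range_zero]
    split_ifs <;> omega
  rw [← card_forkTypes i hn, ← hshort, ← Finset.card_disjSum, indecCount]
  refine ncard_eq_of_image _
    (Sum.elim (fun x => fork x.1 x.2 ((n - x.1 - x.2 - 3) / 2)) (fun k => skewInc k 1)) ?_ ?_
  · rintro (⟨a, b⟩ | k) hx (⟨a', b'⟩ | k') hy he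
    · simp only [Finset.inl_mem_disjSum, hmem, Sum.elim_inl] at hx hy he
      obtain ⟨rfl, rfl, -⟩ := fork_inj he (by omega) (by omega)
      rfl
    · simp only [Finset.inl_mem_disjSum, hmem, Sum.elim_inl, Sum.elim_inr] at hx he
      exact absurd he (fork_ne_skewInc (by omega))
    · simp only [Finset.inl_mem_disjSum, hmem, Sum.elim_inl, Sum.elim_inr] at hy he
      exact absurd he.symm (fork_ne_skewInc (by omega))
    · have := congrArg Sigma.fst he
      simp only [Sum.elim_inr, skewInc_fst] at this
      obtain rfl : k = k' := by omega
      rfl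
  · intro π
    simp only [Set.mem_ofPred_eq, indec_mem_av_truncatedBasis_iff]
    constructor
    · rintro ⟨⟨k, hk, rfl⟩ | ⟨a, b, m, ha, hb, hne, rfl⟩, hl⟩
      · refine ⟨Sum.inr k, ?_, rfl⟩
        simp only [skewInc_fst] at hl
        simp only [Finset.inr_mem_disjSum, Finset.mem_filter, Finset.mem_range]
        omega
      · simp only [fork_fst] at hl
        refine ⟨Sum.inl (a, b), ?_, ?_⟩
        · simp only [Finset.inl_mem_disjSum, hmem]
          omega
        · simp only [Sum.elim_inl]
          congr 1
          omega
    · rintro ⟨⟨a, b⟩ | k, hx, rfl⟩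
      · simp only [Finset.inl_mem_disjSum, hmem] at hx
        refine ⟨Or.inr ⟨a, b, _, by omega, by omega, by omega, rfl⟩, ?_⟩
        simp only [Sum.elim_inl, fork_fst]
        omega
      · simp only [Finset.inr_mem_disjSum, Finset.mem_filter, Finset.mem_range] at hx
        exact ⟨Or.inl ⟨k, by omega, rfl⟩, hx.2⟩

theorem hasGrowthRate_truncatedClass (i : ℕ) {γ : ℝ} (h2 : 2 < γ)
    (hP : 0 ≤ γ ^ 5 - 2 * γ ^ 4 - γ ^ 2 - γ - 1)
    (h : (γ ^ 5 - 2 * γ ^ 4 - γ ^ 2 - γ - 1) * (γ + 1) * γ ^ (2 * i + 3) - 1 = 0) :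
    HasGrowthRate (truncatedClass i) γ := by
  rw [truncatedClass_eq_av]
  set P := γ ^ 5 - 2 * γ ^ 4 - γ ^ 2 - γ - 1 with hPdef
  have h1 : γ - 1 ≠ 0 := by linarith
  have h1' : 0 < γ - 1 := by linarith
  have h3 : γ + 1 ≠ 0 := by linarith
  have h0 : 0 < γ := by linarith
  -- Closed form of the tails: four initial values, a solution of `t ↦ γ * t - 4` while `s = 4`,
  -- then the solution of period two once `s` alternates between 5 and 4.
  let t : ℕ → ℝ := fun n =>
    if n = 0 then 1 else if n = 1 then γ - 1 else if n = 2 then γ ^ 2 - γ - 1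
    else if n = 3 then γ ^ 3 - γ ^ 2 - γ - 2
    else if n < 2 * i + 8 then (4 + P * γ ^ (n - 4)) / (γ - 1)
    else if n % 2 = 0 then (5 * γ + 4) / ((γ - 1) * (γ + 1))
    else (4 * γ + 5) / ((γ - 1) * (γ + 1))
  -- The last two regimes agree at `n = 2 * i + 8` exactly because `γ` is a root.
  have hlim : (4 + P * γ ^ (2 * i + 4)) / (γ - 1) = (5 * γ + 4) / ((γ - 1) * (γ + 1)) := by
    have e : P * γ ^ (2 * i + 4) = γ / (γ + 1) := by
      field_simp
      linear_combination γ * h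
    rw [e]
    field_simp
    ring
  have ht4 : ∀ n, 4 ≤ n → n ≤ 2 * i + 8 → t n = (4 + P * γ ^ (n - 4)) / (γ - 1) := by
    intro n hn hn'
    simp only [t]
    rcases hn'.eq_or_lt with rfl | hlt
    · rw [if_neg (by omega), if_neg (by omega), if_neg (by omega), if_neg (by omega),
        if_neg (by omega), if_pos (by omega), show 2 * i + 8 - 4 = 2 * i + 4 by omega, hlim]
    · rw [if_neg (by omega), if_neg (by omega), if_neg (by omega), if_neg (by omega), if_pos hlt]
  have htge : ∀ n, 2 * i + 8 ≤ n → t n = if n % 2 = 0 then (5 * γ + 4) / ((γ - 1) * (γ + 1))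
      else (4 * γ + 5) / ((γ - 1) * (γ + 1)) := by
    intro n hn
    simp only [t]
    rw [if_neg (by omega), if_neg (by omega), if_neg (by omega), if_neg (by omega),
      if_neg (by omega)]
  have htail0 : 0 ≤ (5 * γ + 4) / ((γ - 1) * (γ + 1)) := by positivity
  have htail1 : 0 ≤ (4 * γ + 5) / ((γ - 1) * (γ + 1)) := by positivity
  obtain ⟨K, hK⟩ : ∃ K, ∀ n, t n ≤ K := by
    refine ⟨(∑ n ∈ Finset.range (2 * i + 8), |t n|) + (5 * γ + 4) / ((γ - 1) * (γ + 1)) +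
      (4 * γ + 5) / ((γ - 1) * (γ + 1)), fun n => ?_⟩
    have hsum : 0 ≤ ∑ n ∈ Finset.range (2 * i + 8), |t n| :=
      Finset.sum_nonneg fun _ _ => abs_nonneg _
    rcases Nat.lt_or_ge n (2 * i + 8) with hlt | hge
    · have h4 : |t n| ≤ ∑ n ∈ Finset.range (2 * i + 8), |t n| :=
        Finset.single_le_sum (f := fun n => |t n|) (fun k _ => abs_nonneg _)
          (Finset.mem_range.mpr hlt)
      have := le_abs_self (t n)
      linarith
    · rw [htge n hge]
      split_ifs <;> linarith
  refine hasGrowthRate_av (indec_truncatedBasis i) (s := truncatedSeq i) (t := t) (K := K)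
    (fun n hn => indecCount_truncated i hn) rfl rfl h0 rfl ?_ ?_ hK
  · intro n
    obtain rfl | rfl | rfl | rfl | hn : n = 0 ∨ n = 1 ∨ n = 2 ∨ n = 3 ∨ 4 ≤ n := by omega
    · simp [t, truncatedSeq]
    · simp [t, truncatedSeq]
      ring
    · simp [t, truncatedSeq]
      ring
    · rw [ht4 (3 + 1) (by omega) (by omega)]
      simp [t, truncatedSeq]
      rw [div_eq_iff h1, hPdef]
      ring
    · rcases Nat.lt_or_ge n (2 * i + 8) with hlt | hge
      · rw [ht4 n hn hlt.le, ht4 (n + 1) (by omega) (by omega),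
          show n + 1 - 4 = (n - 4) + 1 by omega]
        have : truncatedSeq i (n + 1) = 4 := by
          unfold truncatedSeq
          split_ifs <;> omega
        rw [this]
        push_cast
        field_simp
        ring
      · rw [htge n hge, htge (n + 1) (by omega)]
        rcases Nat.mod_two_eq_zero_or_one n with e | e
        · have : truncatedSeq i (n + 1) = 5 := by
            unfold truncatedSeq
            split_ifs <;> omega
          rw [if_neg (by omega), if_pos e, this]
          push_cast
          field_simp
          ring
        · have : truncatedSeq i (n + 1) = 4 := by
            unfold truncatedSeq
            split_ifs <;> omega
          rw [if_pos (by omega), if_neg (by omega), this]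
          push_cast
          field_simp
          ring
  · intro n
    simp only [t]
    split_ifs
    · norm_num
    · linarith
    · nlinarith
    · nlinarith [mul_nonneg (show 0 ≤ γ - 2 by linarith) (show 0 ≤ γ ^ 2 + γ + 1 by positivity)]
    · positivity
    · exact htail0
    · exact htail1

/-! ### A finitely based class with growth rate `ξ` -/

/-- The basis of the sum closure of the permutations `skewInc k m` with `k ≤ 2` or `m ≤ 2`. -/
def skewBasis : Set FinPerm := {perm321, perm2413, perm3142, perm456123}

theorem skewBasis_finite : skewBasis.Finite := by
  unfold skewBasis
  exact Set.toFinite _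

theorem indec_skewBasis : ∀ β ∈ skewBasis, Indec β := by
  rintro β (rfl | rfl | rfl | rfl)
  · exact indec_perm321
  · exact indec_perm2413
  · exact indec_perm3142
  · exact indec_perm456123

section Reading

variable {π : FinPerm}

theorem pos_lt_pos_of_hole (h321 : ¬ Contained perm321 π) {m y z : ℕ} (hπ : 0 < π.1)
    (hm : val π 0 = m) (hyz : y < z) (hz : z < m) : pos π y < pos π z := by
  have h0 := val_lt hπ
  refine pos_lt_pos_of_lt h321 hπ hyz (by omega) (Nat.pos_of_ne_zero fun h => ?_)
  have := val_pos (π := π) (y := z) (by omega)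
  rw [h] at this
  omega

/-- An indecomposable permutation avoiding three patterns starts with consecutive increasing
entries until it reaches its least entry. -/
theorem val_before_min (hπ : Indec π) (h321 : ¬ Contained perm321 π)
    (h2413 : ¬ Contained perm2413 π) {m : ℕ} (hm : val π 0 = m) (p : ℕ) :
    p < pos π 0 → val π p = p + m := by
  have h0 := val_lt hπ.1
  have hz := val_pos hπ.1
  have hzn := pos_lt hπ.1
  induction p using Nat.strong_induction_on with
  | _ p ih =>
    intro hp
    rcases Nat.eq_zero_or_pos p with rfl | hp0
    · omega
    have hvp := val_lt (π := π) (p := p) (by omega)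
    have hge : m < val π p := by
      by_contra hc
      have hne : val π p ≠ m := fun h => by
        have := val_inj (π := π) (p := p) (q := 0) (by omega) hπ.1 (by omega)
        omega
      have hne0 : val π p ≠ 0 := fun h => by
        have := val_inj (π := π) (p := p) (q := pos π 0) (by omega) hzn (by omega)
        omega
      have := pos_lt_pos_of_hole h321 hπ.1 hm (y := 0) (z := val π p) (by omega) (by omega)
      rw [pos_val (by omega)] at this
      omega
    have hge' : p + m ≤ val π p := by
      by_contra hc
      have h1 := ih (val π p - m) (by omega) (by omega)
      have := val_inj (π := π) (p := val π p - m) (q := p) (by omega) (by omega) (by omega)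
      omega
    by_contra hne
    -- the skipped value `p + m` occurs after the least entry
    have hy := val_pos (π := π) (y := p + m) (by omega)
    have hyn := pos_lt (π := π) (y := p + m) (by omega)
    have hyp : p < pos π (p + m) := by
      by_contra hc
      rcases Nat.lt_or_ge (pos π (p + m)) p with h | h
      · have := ih _ h (by omega)
        omega
      · have : pos π (p + m) = p := by omega
        rw [this] at hy
        omega
    have hm0 : 0 < m := by
      by_contra hc
      have := val_inj hπ.1 hzn (by omega)
      omega
    have hlt := pos_lt_pos_of_lt h321 (p := p) (y := 0) (z := p + m)
      (by omega) (by omega) (by omega) hyp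
    -- The first entry, the jump, the least entry and the skipped value, in this order.
    exact h2413 (contained_perm2413_iff.mpr
      ⟨0, p, pos π 0, pos π (p + m), by omega, by omega⟩)

/-- An entry interrupting the run 0, 1, 2, ... of values below `m` would exceed `m`, and so play the
4 of a 3142. -/
theorem val_after_min (hπ : Indec π) (h321 : ¬ Contained perm321 π)
    (h3142 : ¬ Contained perm3142 π) {m : ℕ}
    (hm : val π 0 = m) (r : ℕ) : r < m → pos π r = pos π 0 + r := by
  have h0 := val_lt hπ.1
  have hz := val_pos hπ.1
  have hzn := pos_lt hπ.1
  induction r using Nat.strong_induction_on with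
  | _ r ih =>
    intro hr
    rcases Nat.eq_zero_or_pos r with rfl | hr0
    · rfl
    have hpr := val_pos (π := π) (y := r) (by omega)
    have hprn := pos_lt (π := π) (y := r) (by omega)
    have hlt := pos_lt_pos_of_hole h321 hπ.1 hm (y := r - 1) (z := r) (by omega) hr
    rw [ih (r - 1) (by omega) (by omega)] at hlt
    by_contra hne
    obtain ⟨q, hq⟩ : ∃ q, q = pos π 0 + r := ⟨_, rfl⟩
    have hqv := val_lt (π := π) (p := q) (by omega)
    have hpq := pos_val (π := π) (p := q) (by omega)
    have h1 : m < val π q := by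
      by_contra hc
      rcases Nat.lt_or_ge (val π q) r with h | h
      · have := ih _ h (by omega)
        omega
      · rcases h.eq_or_lt with h | h
        · rw [← h] at hpq
          omega
        · rcases Nat.lt_or_ge (val π q) m with h' | h'
          · have := pos_lt_pos_of_hole h321 hπ.1 hm h h'
            omega
          · have := val_inj (π := π) (p := q) (q := 0) (by omega) hπ.1 (by omega)
            omega
    have hz0 : 0 < pos π 0 := by
      by_contra hc
      have : pos π 0 = 0 := by omega
      rw [this] at hz
      omega
    exact h3142 (contained_perm3142_iff.mpr
      ⟨0, pos π 0, q, pos π r, by omega, by omega⟩)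

/-- The entries up to the least one and the values below the first entry form two consecutive runs
filling a closed prefix, which is all of `π`. The one-point permutation is written `skewInc 1 0`, so
that `k` alone indexes each length. -/
theorem eq_skewInc (hπ : Indec π) (h321 : ¬ Contained perm321 π)
    (h2413 : ¬ Contained perm2413 π) (h3142 : ¬ Contained perm3142 π) :
    (∃ k m, 0 < k ∧ 0 < m ∧ π = skewInc k m) ∨ π = skewInc 1 0 := by
  have h0 := val_lt hπ.1
  rcases Nat.eq_zero_or_pos (val π 0) with hm | hm
  · right
    have hl := hπ.length_eq one_pos hπ.1 fun p hp => by
      obtain rfl : p = 0 := by omega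
      omega
    refine ext_val hl fun p hp => ?_
    obtain rfl : p = 0 := by omega
    rw [val_skewInc (by omega)]
    simpa using hm
  · left
    have hb := val_before_min hπ h321 h2413 rfl
    have ha := val_after_min hπ h321 h3142 rfl
    have hlast := ha (val π 0 - 1) (by omega)
    have hlastn := pos_lt (π := π) (y := val π 0 - 1) (by omega)
    have hafter : ∀ r, r < val π 0 → val π (pos π 0 + r) = r := fun r hr => by
      rw [← ha r hr, val_pos (by omega)]
    have hz := val_pos hπ.1
    have hz0 : 0 < pos π 0 := by
      by_contra hc
      have : pos π 0 = 0 := by omega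
      rw [this] at hz
      omega
    have hv : ∀ p, p < pos π 0 + val π 0 →
        val π p = if p < pos π 0 then p + val π 0 else p - pos π 0 := by
      intro p hp
      split_ifs with h
      · exact hb p h
      · have := hafter (p - pos π 0) (by omega)
        rwa [Nat.add_sub_cancel' (by omega)] at this
    have hl : π.1 = pos π 0 + val π 0 := by
      refine hπ.length_eq (by omega) (by omega) fun p hp => ?_
      rw [hv p hp]
      split_ifs <;> omega
    refine ⟨pos π 0, val π 0, hz0, hm, ext_val hl fun p hp => ?_⟩
    rw [val_skewInc (by omega), hv p (by omega)]

end Reading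

theorem skewInc_inversion {k m p q : ℕ} (hpq : p < q) (hq : q < k + m)
    (h : val (skewInc k m) q < val (skewInc k m) p) : p < k ∧ k ≤ q := by
  rw [val_skewInc hq, val_skewInc (by omega)] at h
  split_ifs at h <;> omega

theorem lt_val_skewInc {k m p q : ℕ} (hpk : p < k) (hkq : k ≤ q) (hq : q < k + m) :
    val (skewInc k m) q < val (skewInc k m) p := by
  rw [val_skewInc hq, val_skewInc (by omega), if_pos hpk, if_neg (by omega)]
  omega

theorem contained_perm456123_skewInc {k m : ℕ} (hk : 3 ≤ k) (hm : 3 ≤ m) :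
    Contained perm456123 (skewInc k m) := by
  refine contained_perm456123_iff.mpr ⟨0, 1, 2, k, k + 1, k + 2, by simp; omega, ?_⟩
  simp only [val_skewInc (show 0 < k + m by omega), val_skewInc (show 1 < k + m by omega),
    val_skewInc (show 2 < k + m by omega), val_skewInc (show k < k + m by omega),
    val_skewInc (show k + 1 < k + m by omega), val_skewInc (show k + 2 < k + m by omega)]
  split_ifs <;> omega

theorem skewInc_mem_av {k m : ℕ} (h : k ≤ 2 ∨ m ≤ 2) : skewInc k m ∈ Av skewBasis := by
  rintro β (rfl | rfl | rfl | rfl)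
  · rw [contained_perm321_iff]
    rintro ⟨a, b, c, hl, hv⟩
    rw [skewInc_fst] at hl
    have h1 := skewInc_inversion (k := k) (m := m) (p := a) (q := b)
      (by omega) (by omega) (by omega)
    have h2 := skewInc_inversion (k := k) (m := m) (p := b) (q := c)
      (by omega) (by omega) (by omega)
    omega
  · rw [contained_perm2413_iff]
    rintro ⟨a, b, c, d, hl, hv⟩
    rw [skewInc_fst] at hl
    have h1 := skewInc_inversion (k := k) (m := m) (p := a) (q := c)
      (by omega) (by omega) (by omega)
    have h2 := lt_val_skewInc (k := k) (m := m) (p := a) (q := d) (by omega) (by omega) (by omega)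
    omega
  · rw [contained_perm3142_iff]
    rintro ⟨a, b, c, d, hl, hv⟩
    rw [skewInc_fst] at hl
    have h1 := skewInc_inversion (k := k) (m := m) (p := a) (q := b)
      (by omega) (by omega) (by omega)
    have h2 := skewInc_inversion (k := k) (m := m) (p := c) (q := d)
      (by omega) (by omega) (by omega)
    omega
  · rw [contained_perm456123_iff]
    rintro ⟨a, b, c, d, e, f, hl, hv⟩
    rw [skewInc_fst] at hl
    have h1 := skewInc_inversion (k := k) (m := m) (p := c) (q := d)
      (by omega) (by omega) (by omega)
    omega

theorem indec_mem_av_skewBasis_iff {π : FinPerm} : Indec π ∧ π ∈ Av skewBasis ↔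
    (∃ k m, 0 < k ∧ 0 < m ∧ (k ≤ 2 ∨ m ≤ 2) ∧ π = skewInc k m) ∨ π = skewInc 1 0 := by
  constructor
  · rintro ⟨hπ, h⟩
    rcases eq_skewInc hπ (h _ (by simp [skewBasis])) (h _ (by simp [skewBasis]))
      (h _ (by simp [skewBasis])) with ⟨k, m, hk, hm, rfl⟩ | h'
    · refine Or.inl ⟨k, m, hk, hm, ?_, rfl⟩
      by_contra hc
      exact h perm456123 (by simp [skewBasis]) (contained_perm456123_skewInc (by omega) (by omega))
    · exact Or.inr h'
  · rintro (⟨k, m, hk, hm, h, rfl⟩ | rfl)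
    · exact ⟨indec_skewInc hm (Or.inl hk), skewInc_mem_av h⟩
    · refine ⟨⟨by simp, fun j hj hjn => ?_⟩, skewInc_mem_av (by omega)⟩
      simp only [skewInc_fst] at hjn
      omega

/-- The number of indecomposable members of length `n` of `Av skewBasis`. -/
def skewSeq (n : ℕ) : ℕ :=
  if n ≤ 1 then n else if n ≤ 4 then n - 1 else 4

theorem indecCount_skew {n : ℕ} (hn : 0 < n) : indecCount (Av skewBasis) n = skewSeq n := by
  have hcard : (((Finset.Icc 1 n).filter fun k => (k < n ∧ (k ≤ 2 ∨ n ≤ k + 2)) ∨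
      (n = 1 ∧ k = 1))).card = skewSeq n := by
    unfold skewSeq
    by_cases h4 : n ≤ 4
    · interval_cases n <;> rfl
    · have : ((Finset.Icc 1 n).filter fun k => (k < n ∧ (k ≤ 2 ∨ n ≤ k + 2)) ∨
          (n = 1 ∧ k = 1)) = {1, 2, n - 2, n - 1} := by
        ext k
        simp only [Finset.mem_filter, Finset.mem_Icc, Finset.mem_insert, Finset.mem_singleton]
        omega
      rw [this, Finset.card_insert_of_notMem, Finset.card_insert_of_notMem,
        Finset.card_pair (by omega)]
      · split_ifs <;> omega
      · simp only [Finset.mem_insert, Finset.mem_singleton]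
        omega
      · simp only [Finset.mem_insert, Finset.mem_singleton]
        omega
  rw [← hcard, indecCount]
  refine ncard_eq_of_image _ (fun k => skewInc k (n - k)) ?_ ?_
  · intro k hk k' hk' he
    simp only [Finset.mem_filter, Finset.mem_Icc] at hk hk'
    have h1 := val_skewInc (k := k) (m := n - k) (p := 0) (by omega)
    rw [he, val_skewInc (by omega), if_pos (by omega), if_pos (by omega)] at h1
    omega
  · intro π
    simp only [Set.mem_ofPred_eq, indec_mem_av_skewBasis_iff, Finset.mem_filter, Finset.mem_Icc]
    constructor
    · rintro ⟨⟨k, m, hk, hm, h, rfl⟩ | rfl, hl⟩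
      · simp only [skewInc_fst] at hl
        exact ⟨k, by omega, by congr 1; omega⟩
      · simp only [skewInc_fst] at hl
        exact ⟨1, by omega, by congr 1; omega⟩
    · rintro ⟨k, hk, rfl⟩
      refine ⟨?_, by simp only [skewInc_fst]; omega⟩
      rcases hk.2 with h | ⟨rfl, rfl⟩
      · exact Or.inl ⟨k, n - k, by omega, by omega, by omega, rfl⟩
      · exact Or.inr rfl

theorem hasGrowthRate_skew {ξ : ℝ} (h2 : 2 < ξ) (hξ : ξ ^ 5 - 2 * ξ ^ 4 - ξ ^ 2 - ξ - 1 = 0) :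
    HasGrowthRate (Av skewBasis) ξ := by
  have h1 : ξ - 1 ≠ 0 := by linarith
  have h1' : 0 < ξ - 1 := by linarith
  have h0 : 0 < ξ := by linarith
  -- From `n = 4` on `s = 4`, and the tail sits at the fixed point of `t ↦ ξ * t - 4`; it arrives
  -- there because `ξ` is a root of the quintic.
  let t : ℕ → ℝ := fun n =>
    if n = 0 then 1 else if n = 1 then ξ - 1 else if n = 2 then ξ ^ 2 - ξ - 1
    else if n = 3 then ξ ^ 3 - ξ ^ 2 - ξ - 2 else 4 / (ξ - 1)
  have e1 : 0 ≤ ξ ^ 2 - ξ - 1 := by nlinarith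
  have e2 : 0 ≤ ξ ^ 3 - ξ ^ 2 - ξ - 2 := by
    nlinarith [mul_nonneg (show 0 ≤ ξ - 2 by linarith) (show 0 ≤ ξ ^ 2 + ξ + 1 by positivity)]
  have e3 : 0 ≤ 4 / (ξ - 1) := by positivity
  refine hasGrowthRate_av indec_skewBasis (s := skewSeq) (t := t)
    (K := 1 + (ξ - 1) + (ξ ^ 2 - ξ - 1) + (ξ ^ 3 - ξ ^ 2 - ξ - 2) + 4 / (ξ - 1))
    (fun n hn => indecCount_skew hn) rfl rfl h0 rfl ?_ ?_ ?_
  · intro n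
    obtain rfl | rfl | rfl | rfl | hn : n = 0 ∨ n = 1 ∨ n = 2 ∨ n = 3 ∨ 4 ≤ n := by omega
    · simp [t, skewSeq]
    · simp [t, skewSeq]
      ring
    · simp [t, skewSeq]
      ring
    · simp [t, skewSeq]
      rw [div_eq_iff h1]
      linear_combination -hξ
    · have : skewSeq (n + 1) = 4 := by
        unfold skewSeq
        split_ifs <;> omega
      simp only [t]
      rw [if_neg (by omega), if_neg (by omega), if_neg (by omega), if_neg (by omega),
        if_neg (by omega), if_neg (by omega), if_neg (by omega), if_neg (by omega), this]
      push_cast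
      field_simp
      ring
  · intro n
    simp only [t]
    split_ifs <;> linarith
  · intro n
    simp only [t]
    split_ifs <;> linarith

end PermClasses

/-! ### The main theorem -/

theorem mainTheorem3 :
    ∃ ξ : ℝ,
      -- `ξ` is the unique positive root of its polynomial
      (∀ x : ℝ, (0 < x ∧ x ^ 5 - 2 * x ^ 4 - x ^ 2 - x - 1 = 0) ↔ x = ξ) ∧
      |ξ - 2.30522| < 0.00001 ∧
      (∃ γ : ℕ → ℝ,
        (∀ i : ℕ,
          PermClasses.FinitelyBased (PermClasses.truncatedClass i) ∧
          PermClasses.HasGrowthRate (PermClasses.truncatedClass i) (γ i) ∧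
          IsGreatest
            {x : ℝ | (x ^ 5 - 2 * x ^ 4 - x ^ 2 - x - 1) * (x + 1) * x ^ (2 * i + 3) - 1 = 0}
            (γ i)) ∧
        -- the growth rates accumulate at `ξ` from above
        (∀ i : ℕ, ξ < γ i) ∧
        Filter.Tendsto γ Filter.atTop (nhds ξ)) ∧
      (∃ C : Set PermClasses.FinPerm,
        PermClasses.IsPermClass C ∧ PermClasses.FinitelyBased C ∧
          PermClasses.HasGrowthRate C ξ) ∧
      -- the gap property asked for by Klazar fails
      ¬ (∀ α ∈ PermClasses.finitelyBasedGrowthRates, ∃ δ : ℝ, 0 < δ ∧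
          Set.Ioo α (α + δ) ∩ PermClasses.finitelyBasedGrowthRates = ∅) := by
  obtain ⟨ξ, hξ1, hξ2, hξ⟩ := PermClasses.exists_quintic_root
  have h2 : 2 < ξ := by linarith
  choose γ hγ1 hγ2 hγ3 using PermClasses.exists_greatest_root h2.le hξ
  have hfb : ∀ i, PermClasses.FinitelyBased (PermClasses.truncatedClass i) := fun i => by
    rw [PermClasses.truncatedClass_eq_av]
    exact PermClasses.finitelyBased_av (PermClasses.truncatedBasis_finite i)
  have hgr : ∀ i, PermClasses.HasGrowthRate (PermClasses.truncatedClass i) (γ i) := fun i => by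
    have h := PermClasses.quintic_sub_le h2.le (hγ1 i).le
    have := hγ1 i
    exact PermClasses.hasGrowthRate_truncatedClass i (by linarith) (by linarith) (hγ3 i).1
  have hlim : Filter.Tendsto γ Filter.atTop (nhds ξ) := by
    have h : Filter.Tendsto (fun i : ℕ => ξ + (1 / 2 : ℝ) ^ i) Filter.atTop (nhds (ξ + 0)) :=
      tendsto_const_nhds.add (tendsto_pow_atTop_nhds_zero_of_lt_one (by norm_num) (by norm_num))
    rw [add_zero] at h
    exact tendsto_of_tendsto_of_tendsto_of_le_of_le tendsto_const_nhds h
      (fun i => (hγ1 i).le) hγ2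
  have hC : PermClasses.IsPermClass (PermClasses.Av PermClasses.skewBasis) ∧
      PermClasses.FinitelyBased (PermClasses.Av PermClasses.skewBasis) ∧
      PermClasses.HasGrowthRate (PermClasses.Av PermClasses.skewBasis) ξ :=
    ⟨PermClasses.isPermClass_av _, PermClasses.finitelyBased_av PermClasses.skewBasis_finite,
      PermClasses.hasGrowthRate_skew h2 hξ⟩
  refine ⟨ξ, PermClasses.quintic_root_unique h2.le hξ, ?_,
    ⟨γ, fun i => ⟨hfb i, hgr i, hγ3 i⟩, hγ1, hlim⟩, ⟨_, hC⟩, fun hgap => ?_⟩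
  · rw [abs_lt]
    constructor <;> linarith
  · obtain ⟨δ, hδ, hempty⟩ := hgap ξ ⟨_, hC⟩
    -- Some `γ i` falls into any right neighbourhood of `ξ`.
    obtain ⟨i, hi⟩ := (hlim.eventually (gt_mem_nhds (show ξ < ξ + δ by linarith))).exists
    have : γ i ∈ Set.Ioo ξ (ξ + δ) ∩ PermClasses.finitelyBasedGrowthRates := by
      refine ⟨⟨hγ1 i, hi⟩, PermClasses.truncatedClass i, ?_, hfb i, hgr i⟩
      rw [PermClasses.truncatedClass_eq_av]
      exact PermClasses.isPermClass_av _
    rw [hempty] at this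
    exact this
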